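/- Let $m\ge 2$ and $N>2m$ be integers. For given real numbers $a_0,\dots,a_{m-1}$ consider the initial value problem $$(-\Delta)^m u=e^u \ \text{ on } (0,\infty),\qquad u^{(2k+1)}(0)=0,\quad \Delta^k u(0)=a_k\qquad(0\le k\le m-1),\tag{1.2}$$ for functions $u\in C^{2m}([0,\infty))$, where $\Delta w=r^{1-N}(r^{N-1}w')'$ is the radial Laplacian in dimension $N$ and $\Delta^k u(0)=\lim_{r\to0^+}\Delta^k u(r)$. A solution $U$ of $(-\Delta)^mU=e^U$ in $\mathbb R^N$ is called stable in $\mathbb R^N$ if for every $\phi\in C_0^\infty(\mathbb R^N)$ $$\int_{\mathbb R^N}|\nabla(\Delta^{\frac{m-1}{2}}\phi)|^2\,dx-\int_{\mathbb R^N}e^{U}\phi^2\,dx\ge 0\ \text{ if } m \text{ is odd},\qquad \int_{\mathbb R^N}|\Delta^{\frac m2}\phi|^2\,dx-\int_{\mathbb R^N}e^{U}\phi^2\,dx\ge 0\ \text{ if } m\text{ is even}.$$ **Theorem 1.1.** For any given real numbers $a_0,\dots,a_{m-2}$ there exists $\beta\in\mathbb R$ such that for every $a_{m-1}\le\beta$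 the problem (1.2) has exactly one global solution $u$ on $[0,\infty)$, and the radial function $U(x)=u(|x|)$ is a smooth solution of $(-\Delta)^mU=e^U$ in $\mathbb R^N$ which is stable in $\mathbb R^N$. -/

import Mathlib

open Set Filter Topology MeasureTheory
open scoped ContDiff

namespace Polyharmonic

/-- `N`-dimensional Euclidean space. -/
abbrev RN (N : ℕ) : Type := EuclideanSpace ℝ (Fin N)

/-- The radial Laplacian `w ↦ r^{1-N} (r^{N-1} w')'` in dimension `N`. It is only ever evaluated at
`r > 0`, where it depends on the germ of `w` at `r` alone. -/
noncomputable def radialLaplacian (N : ℕ) (w : ℝ → ℝ) (r : ℝ) : ℝ :=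
  r ^ (1 - (N : ℤ)) * deriv (fun s => s ^ ((N : ℤ) - 1) * deriv w s) r

/-- `u`, restricted to `[0, ∞)`, is a global solution of the initial value problem
`(-Δ)^m u = e^u`, `u^{(2k+1)}(0) = 0`, `Δ^k u(0) = a_k` for `0 ≤ k ≤ m - 1`, where `Δ` is the radial
Laplacian in dimension `N`. The values of `u` at negative numbers play no role. -/
structure IsGlobalSolution (N m : ℕ) (a : Fin m → ℝ) (u : ℝ → ℝ) : Prop where
  /-- `u` is `C^{2m}` on `[0, ∞)`, with one-sided derivatives at `0`. -/
  contDiffOn : ContDiffOn ℝ ((2 * m : ℕ) : ℕ∞) u (Ici 0)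
  /-- The equation. -/
  equation : ∀ r : ℝ, 0 < r → (-1) ^ m * (radialLaplacian N)^[m] u r = Real.exp (u r)
  /-- The derivatives of odd order `1, 3, …, 2m - 1` vanish at `0`. -/
  odd_deriv : ∀ k : ℕ, k < m → iteratedDerivWithin (2 * k + 1) u (Ici 0) 0 = 0
  /-- `Δ^k u(0) = a_k`; the value of `Δ^k u` at `0` is its limit as `r → 0⁺`
  (the coefficient `r^{1-N}` is singular at `0`). For `k = 0` this says `u(0) = a_0`. -/
  initial : ∀ k : Fin m, Tendsto ((radialLaplacian N)^[(k : ℕ)] u) (𝓝[>] 0) (𝓝 (a k))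

/-- The radial function on `ℝ^N` with profile `u`. -/
noncomputable def radialFunction (N : ℕ) (u : ℝ → ℝ) : RN N → ℝ := fun x => u ‖x‖

/-- `U` is a smooth classical solution of `(-Δ)^m U = e^U` in `ℝ^N`. -/
structure IsEntireSolution (N m : ℕ) (U : RN N → ℝ) : Prop where
  contDiff : ContDiff ℝ ∞ U
  equation : ∀ x : RN N, (-1) ^ m * (Laplacian.laplacian)^[m] U x = Real.exp (U x)

/-- The energy `∫ |∇ Δ^{(m-1)/2} φ|²` for odd `m`, and `∫ |Δ^{m/2} φ|²` for even `m`. -/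
noncomputable def energy (N m : ℕ) (φ : RN N → ℝ) : ℝ :=
  if Odd m then ∫ x : RN N, ‖gradient ((Laplacian.laplacian)^[(m - 1) / 2] φ) x‖ ^ 2
  else ∫ x : RN N, ((Laplacian.laplacian)^[m / 2] φ x) ^ 2

/-- `U` is a stable solution of `(-Δ)^m U = e^U` in `ℝ^N`. -/
structure IsStableSolution (N m : ℕ) (U : RN N → ℝ) : Prop where
  isEntireSolution : IsEntireSolution N m U
  stable : ∀ φ : RN N → ℝ, ContDiff ℝ ∞ φ → HasCompactSupport φ →
    0 ≤ energy N m φ - ∫ x : RN N, Real.exp (U x) * φ x ^ 2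

end Polyharmonic

/-! Everything is written in the variable t = r². There the radial Laplacian becomes 4t g'' + 2N g'
(`sqLaplacian`), which is regular at t = 0 and has the positive integral right inverse `sqInv`. With
m = n + 1 and b = a_{m-1}, the problem for u(r) = g(r²) becomes the fixed point equation g =
`sqSolve N α n F`, where F = b + (-1)^m `sqInv` (e^g). A profile g that is smooth on all of ℝ makes
U(x) = g(|x|²) smooth, also at the origin.

Existence and decay come from one self-consistent bound. As long as F ≤ b/2, positivity of `sqInv`
gives g ≤ Q, where Q has Δⁿ Q = b/2 and the same lower data. Q is a polynomial in t whose leading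
coefficient is a positive multiple of b, so for very negative b the function e^Q is as small at
infinity as needed. In turn g ≤ Q gives e^g ≤ C(1 + t)⁻², whose image under `sqInv` is at most C/2
because N ≥ 5, hence F ≤ b + C/2 < b/2. Continuity closes the loop (`exists_profile`). The
exponential is first truncated, so that a contraction yields a solution on the whole line
(`exists_truncated_solution`); the bound then shows that the truncation is inactive for t ≥ 0.

Stability follows from a Hardy–Rellich inequality with the smooth weight (δ + |x|²)^{-m}
(`energy_ge`): it suffices that 16^m e^U ≤ (δ + |x|²)^{-m}. Near the origin e^U is dictated by the
fixed data, so δ is taken small; away from it the negative b wins (`exists_exp_poly_decay`).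

Uniqueness (`IsGlobalSolution.eqOn`) is a Gronwall-type iteration in the norm with weight e^{l r²}.
It inverts one radial Laplacian at a time by comparison, and at the origin it uses only the limits
of the iterated Laplacians. -/

namespace Polyharmonic

/-! ### Partial derivatives and the Laplacian on ℝ^N -/

/-- The `i`-th partial derivative. -/
noncomputable def partialDeriv {N : ℕ} (i : Fin N) (f : RN N → ℝ) (x : RN N) : ℝ :=
  fderiv ℝ f x (EuclideanSpace.single i 1)

section PartialDeriv

variable {N : ℕ} {f g : RN N → ℝ} (i : Fin N)

theorem contDiff_partialDeriv (hf : ContDiff ℝ ∞ f) : ContDiff ℝ ∞ (partialDeriv i f) :=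
  (hf.fderiv_right (m := ∞) (by simp)).clm_apply contDiff_const

theorem hasCompactSupport_partialDeriv (hf : HasCompactSupport f) :
    HasCompactSupport (partialDeriv i f) :=
  hf.fderiv_apply (𝕜 := ℝ) _

theorem partialDeriv_add (hf : ContDiff ℝ ∞ f) (hg : ContDiff ℝ ∞ g) (x : RN N) :
    partialDeriv i (fun y => f y + g y) x = partialDeriv i f x + partialDeriv i g x := by
  have h1 := (hf.differentiable (by simp)) x
  have h2 := (hg.differentiable (by simp)) x
  simp only [partialDeriv]
  rw [fderiv_fun_add h1 h2]; rfl

theorem partialDeriv_mul (hf : ContDiff ℝ ∞ f) (hg : ContDiff ℝ ∞ g) (x : RN N) :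
    partialDeriv i (fun y => f y * g y) x = f x * partialDeriv i g x + g x * partialDeriv i f x := by
  have h1 := (hf.differentiable (by simp)) x
  have h2 := (hg.differentiable (by simp)) x
  simp only [partialDeriv]
  rw [fderiv_fun_mul h1 h2]; simp

theorem partialDeriv_const_mul (hf : ContDiff ℝ ∞ f) (c : ℝ) (x : RN N) :
    partialDeriv i (fun y => c * f y) x = c * partialDeriv i f x := by
  have h1 := (hf.differentiable (by simp)) x
  simp only [partialDeriv]
  rw [fderiv_const_mul h1]; simp

theorem partialDeriv_coord (x : RN N) : partialDeriv i (fun y : RN N => y i) x = 1 := by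
  have : fderiv ℝ (fun y : RN N => y i) x = EuclideanSpace.proj i := by
    exact (EuclideanSpace.proj (𝕜 := ℝ) i).fderiv
  simp [partialDeriv, this]

theorem contDiff_coord : ContDiff ℝ ∞ (fun y : RN N => y i) :=
  (EuclideanSpace.proj (𝕜 := ℝ) i : RN N →L[ℝ] ℝ).contDiff

/-- The chain rule for functions of `|x|²`. -/
theorem partialDeriv_comp_normSq {g : ℝ → ℝ} {x : RN N} {g' : ℝ}
    (hg : HasDerivAt g g' (‖x‖ ^ 2)) :
    partialDeriv i (fun y => g (‖y‖ ^ 2)) x = 2 * x i * g' := by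
  have h1 : HasFDerivAt (fun y : RN N => ‖y‖ ^ 2) (2 • innerSL ℝ x) x :=
    (hasStrictFDerivAt_norm_sq x).hasFDerivAt
  have h2 := hg.comp_hasFDerivAt x h1
  have h3 : fderiv ℝ (fun y : RN N => g (‖y‖ ^ 2)) x = g' • (2 • innerSL ℝ x) := h2.fderiv
  simp only [partialDeriv, h3]
  simp [EuclideanSpace.inner_single_right]
  ring

theorem integral_partialDeriv_eq_zero (hf : ContDiff ℝ ∞ f) (hc : HasCompactSupport f) :
    ∫ x, partialDeriv i f x = 0 := by
  have h := integral_mul_fderiv_eq_neg_fderiv_mul_of_integrable (μ := (volume : Measure (RN N)))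
    (f := fun _ : RN N => (1 : ℝ)) (g := f) (v := EuclideanSpace.single i (1 : ℝ))
    (by simp) (by
      simp only [one_mul]
      exact (contDiff_partialDeriv i hf).continuous.integrable_of_hasCompactSupport
        (hasCompactSupport_partialDeriv i hc))
    (by simpa using hf.continuous.integrable_of_hasCompactSupport hc)
    (by intro x _; fun_prop) (by intro x _; exact (hf.differentiable (by simp)) x)
  simpa [partialDeriv] using h

theorem laplacian_eq_sum_partialDeriv (hf : ContDiff ℝ ∞ f) :
    Laplacian.laplacian f = fun x => ∑ i, partialDeriv i (partialDeriv i f) x := by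
  have h := InnerProductSpace.laplacian_eq_iteratedFDeriv_orthonormalBasis (f := f)
    (EuclideanSpace.basisFun (Fin N) ℝ)
  rw [h]
  funext x
  refine Finset.sum_congr rfl fun i _ => ?_
  rw [iteratedFDeriv_two_apply]
  have hd : DifferentiableAt ℝ (fderiv ℝ f) x :=
    ((hf.fderiv_right (m := ∞) (by simp)).differentiable (by simp)) x
  have : fderiv ℝ (partialDeriv i f) x
      = (fderiv ℝ (fderiv ℝ f) x).flip (EuclideanSpace.single i 1) := by
    have h1 := hd.hasFDerivAt.clm_apply (hasFDerivAt_const (EuclideanSpace.single i (1:ℝ)) x)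
    have h2 : fderiv ℝ (partialDeriv i f) x = _ := h1.fderiv
    rw [h2]; simp
  simp [partialDeriv] at this ⊢
  rw [this]; simp

theorem contDiff_laplacian (hf : ContDiff ℝ ∞ f) : ContDiff ℝ ∞ (Laplacian.laplacian f) := by
  rw [laplacian_eq_sum_partialDeriv hf]
  exact ContDiff.sum fun i _ => contDiff_partialDeriv i (contDiff_partialDeriv i hf)

theorem hasCompactSupport_laplacian (hf : ContDiff ℝ ∞ f) (hc : HasCompactSupport f) :
    HasCompactSupport (Laplacian.laplacian f) := by
  refine HasCompactSupport.intro hc fun x hx => ?_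
  rw [laplacian_eq_sum_partialDeriv hf]
  refine Finset.sum_eq_zero fun i _ => ?_
  refine image_eq_zero_of_notMem_tsupport fun h => hx ?_
  exact (tsupport_fderiv_apply_subset ℝ _).trans (tsupport_fderiv_apply_subset ℝ _) h

theorem norm_gradient_sq (x : RN N) (f : RN N → ℝ) :
    ‖gradient f x‖ ^ 2 = ∑ i, partialDeriv i f x ^ 2 := by
  rw [EuclideanSpace.real_norm_sq_eq]
  refine Finset.sum_congr rfl fun i _ => ?_
  congr 1
  have : inner ℝ (gradient f x) (EuclideanSpace.single i (1:ℝ)) = partialDeriv i f x := by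
    simp [gradient, partialDeriv, InnerProductSpace.toDual_symm_apply]
  rw [← this, EuclideanSpace.inner_single_right]; simp

end PartialDeriv

/-! ### The regularized inverse-square weight -/

/-- The weight `(δ + |x|²)⁻¹`. -/
noncomputable def weight (N : ℕ) (δ : ℝ) (x : RN N) : ℝ := (δ + ‖x‖ ^ 2)⁻¹

section Weight

variable {N : ℕ} {δ : ℝ}

theorem weight_pos (hδ : 0 < δ) (x : RN N) : 0 < weight N δ x := by unfold weight; positivity

theorem normSq_mul_weight_le (hδ : 0 < δ) (x : RN N) : ‖x‖ ^ 2 * weight N δ x ≤ 1 := by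
  unfold weight
  rw [← div_eq_mul_inv, div_le_one (by positivity)]; linarith

theorem contDiff_weight_pow (hδ : 0 < δ) (n : ℕ) : ContDiff ℝ ∞ (fun x => weight N δ x ^ n) := by
  refine ContDiff.pow ?_ n
  unfold weight
  refine ContDiff.inv (contDiff_const.add (contDiff_norm_sq ℝ)) fun x => ?_
  positivity

theorem partialDeriv_weight_pow (hδ : 0 < δ) (n : ℕ) (i : Fin N) (x : RN N) :
    partialDeriv i (fun y => weight N δ y ^ n) x = -2 * n * (x i * weight N δ x ^ (n + 1)) := by
  have hp : δ + ‖x‖ ^ 2 ≠ 0 := by positivity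
  have h0 : HasDerivAt (fun t : ℝ => (δ + t)⁻¹ ^ n)
      (n * (δ + ‖x‖ ^ 2)⁻¹ ^ (n - 1) * (-1 / (δ + ‖x‖ ^ 2) ^ 2)) (‖x‖ ^ 2) :=
    (((hasDerivAt_id _).const_add δ).inv hp).pow n
  have := partialDeriv_comp_normSq i h0
  simp only [weight] at this ⊢
  rw [this]
  rcases n with _ | n
  · simp
  · simp only [Nat.add_sub_cancel, pow_succ]
    field_simp

end Weight
-- Hardy–Rellich inequalities and the stability criterion
section Rellich

variable {N : ℕ} {δ : ℝ} {φ : RN N → ℝ}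

theorem integral_sum_partialDeriv_eq_zero {F : Fin N → RN N → ℝ} (hF : ∀ i, ContDiff ℝ ∞ (F i))
    (hc : ∀ i, HasCompactSupport (F i)) : ∫ x, ∑ i, partialDeriv i (F i) x = 0 := by
  rw [integral_finsetSum]
  · exact Finset.sum_eq_zero fun i _ => integral_partialDeriv_eq_zero i (hF i) (hc i)
  · intro i _
    exact (contDiff_partialDeriv i (hF i)).continuous.integrable_of_hasCompactSupport
      (hasCompactSupport_partialDeriv i (hc i))

theorem integrable_sum_partialDeriv {F : Fin N → RN N → ℝ} (hF : ∀ i, ContDiff ℝ ∞ (F i))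
    (hc : ∀ i, HasCompactSupport (F i)) :
    Integrable (fun x => ∑ i, partialDeriv i (F i) x) := by
  refine integrable_finsetSum _ fun i _ => ?_
  exact (contDiff_partialDeriv i (hF i)).continuous.integrable_of_hasCompactSupport
      (hasCompactSupport_partialDeriv i (hc i))

theorem integrable_sq_mul_weight_pow (hδ : 0 < δ) (n : ℕ) (hφ : Continuous φ)
    (hc : HasCompactSupport φ) : Integrable (fun x => φ x ^ 2 * weight N δ x ^ n) := by
  refine Continuous.integrable_of_hasCompactSupport ?_ ?_
  · exact (hφ.pow 2).mul (contDiff_weight_pow hδ n).continuous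
  · refine HasCompactSupport.mul_right ?_
    exact hc.comp_left (g := fun y : ℝ => y ^ 2) (by simp)

theorem integrable_gradSq_mul_weight_pow (hδ : 0 < δ) (n : ℕ) (hφ : ContDiff ℝ ∞ φ)
    (hc : HasCompactSupport φ) :
    Integrable (fun x => (∑ i, partialDeriv i φ x ^ 2) * weight N δ x ^ n) := by
  simp only [Finset.sum_mul]
  refine integrable_finsetSum _ fun i _ => ?_
  exact integrable_sq_mul_weight_pow hδ n (contDiff_partialDeriv i hφ).continuous
    (hasCompactSupport_partialDeriv i hc)

/-- A weighted Hardy inequality. -/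
theorem hardy_weight (hδ : 0 < δ) (n : ℕ) (hN : 2 * n + 3 ≤ N) (hφ : ContDiff ℝ ∞ φ)
    (hc : HasCompactSupport φ) :
    ∫ x, φ x ^ 2 * weight N δ x ^ (n + 1)
      ≤ 4 * ∫ x, (∑ i, partialDeriv i φ x ^ 2) * weight N δ x ^ n := by
  -- The field x σ^{n+1} φ², with σ the weight, has divergence of integral zero. Since |x|²σ ≤ 1,
  -- its φ² coefficient is at least (N - 2(n+1)) σ^{n+1} ≥ σ^{n+1}.
  set F : Fin N → RN N → ℝ := fun i x => (x i * weight N δ x ^ (n + 1)) * (φ x * φ x) with hFdef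
  have hw := fun k => contDiff_weight_pow (N := N) hδ k
  have hF : ∀ i, ContDiff ℝ ∞ (F i) := fun i =>
    ((contDiff_coord i).mul (hw _)).mul (hφ.mul hφ)
  have hFc : ∀ i, HasCompactSupport (F i) := fun i => (hc.mul_left).mul_left
  have hdiv : ∀ x, ∑ i, partialDeriv i (F i) x
      = (N * weight N δ x ^ (n + 1) - 2 * (n + 1) * (‖x‖ ^ 2 * weight N δ x ^ (n + 2))) * φ x ^ 2
        + 2 * φ x * weight N δ x ^ (n + 1) * ∑ i, x i * partialDeriv i φ x := by
    intro x
    have : ∀ i, partialDeriv i (F i) x = weight N δ x ^ (n + 1) * φ x ^ 2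
        - 2 * (n + 1) * (x i ^ 2 * weight N δ x ^ (n + 2)) * φ x ^ 2
        + 2 * φ x * weight N δ x ^ (n + 1) * (x i * partialDeriv i φ x) := by
      intro i
      rw [hFdef]
      rw [partialDeriv_mul i ((contDiff_coord i).mul (hw _)) (hφ.mul hφ), partialDeriv_mul i hφ hφ,
        partialDeriv_mul i (contDiff_coord i) (hw _), partialDeriv_weight_pow hδ,
        partialDeriv_coord]
      push_cast
      ring
    simp only [this, Finset.sum_add_distrib, Finset.sum_sub_distrib, ← Finset.mul_sum,
      ← Finset.sum_mul, Finset.sum_const, Finset.card_univ, Fintype.card_fin, nsmul_eq_mul,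
      EuclideanSpace.real_norm_sq_eq]
    ring
  have hint := integral_sum_partialDeriv_eq_zero hF hFc
  have hI := integrable_sum_partialDeriv hF hFc
  have h1 := integrable_sq_mul_weight_pow hδ (n + 1) hφ.continuous hc
  have h2 := integrable_gradSq_mul_weight_pow hδ n hφ hc
  have key : ∫ x, φ x ^ 2 * weight N δ x ^ (n + 1)
      ≤ ∫ x, (4 * ((∑ i, partialDeriv i φ x ^ 2) * weight N δ x ^ n)
          + 2 * ∑ i, partialDeriv i (F i) x) := by
    refine integral_mono h1 ((h2.const_mul 4).add (hI.const_mul 2)) fun x => ?_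
    simp only
    rw [hdiv]
    have hσ := weight_pos (N := N) hδ x
    have hxσ := normSq_mul_weight_le (N := N) hδ x
    set σ := weight N δ x
    set X := ∑ i, x i * partialDeriv i φ x
    set D := ∑ i, partialDeriv i φ x ^ 2
    have hCS : X ^ 2 ≤ ‖x‖ ^ 2 * D := by
      rw [EuclideanSpace.real_norm_sq_eq]
      exact Finset.sum_mul_sq_le_sq_mul_sq _ _ _
    have hD : 0 ≤ D := Finset.sum_nonneg fun i _ => sq_nonneg _
    have hX : X ^ 2 * σ ≤ D := by
      calc X ^ 2 * σ ≤ ‖x‖ ^ 2 * D * σ := by gcongr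
        _ = (‖x‖ ^ 2 * σ) * D := by ring
        _ ≤ 1 * D := by gcongr
        _ = D := one_mul _
    have hNr : (2 * n + 3 : ℝ) ≤ N := by exact_mod_cast hN
    have hsn : 0 < σ ^ n := pow_pos hσ n
    have hA : 1 * σ ≤ N * σ - 2 * (n + 1) * (‖x‖ ^ 2 * σ) * σ := by
      have : 2 * ((n : ℝ) + 1) * (‖x‖ ^ 2 * σ) ≤ 2 * (n + 1) * 1 := by gcongr
      nlinarith
    -- After the bounds `hX` and `hA` what remains is σ(φ + 2X)², which is where the constant 4
    -- comes from.
    have h3 : 0 ≤ (4 * D + 2 * ((N * σ - 2 * (n + 1) * (‖x‖ ^ 2 * σ) * σ) * φ x ^ 2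
        + 2 * φ x * σ * X) - φ x ^ 2 * σ) := by
      nlinarith [mul_nonneg hσ.le (sq_nonneg (φ x + 2 * X)),
        mul_nonneg (sub_nonneg.2 hA) (sq_nonneg (φ x))]
    have h4 := mul_nonneg h3 hsn.le
    rw [pow_succ σ n, pow_add σ n 2]
    nlinarith [h4]
  rw [integral_add (h2.const_mul 4) (hI.const_mul 2), integral_const_mul, integral_const_mul, hint]
    at key
  linarith

/-- A weighted Rellich inequality. -/
theorem rellich_weight (hδ : 0 < δ) (n : ℕ) (hN : 2 * n + 5 ≤ N) (hφ : ContDiff ℝ ∞ φ)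
    (hc : HasCompactSupport φ) :
    ∫ x, φ x ^ 2 * weight N δ x ^ (n + 2)
      ≤ 16 * ∫ x, Laplacian.laplacian φ x ^ 2 * weight N δ x ^ n := by
  have hw := fun k => contDiff_weight_pow (N := N) hδ k
  have hwx := fun i : Fin N => (contDiff_coord i).mul (hw (n + 2))
  -- The second summand cancels the term φ x·∇φ that arises when the derivative of the first falls
  -- on the weight. It leaves only a multiple of φ², nonnegative because N ≥ 2(n+2).
  set F : Fin N → RN N → ℝ := fun i x => φ x * (partialDeriv i φ x * weight N δ x ^ (n + 1))
    + ((n + 1) * (x i * weight N δ x ^ (n + 2))) * (φ x * φ x) with hFdef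
  have hF : ∀ i, ContDiff ℝ ∞ (F i) := fun i =>
    (hφ.mul ((contDiff_partialDeriv i hφ).mul (hw _))).add
      ((contDiff_const.mul (hwx i)).mul (hφ.mul hφ))
  have hFc : ∀ i, HasCompactSupport (F i) := fun i =>
    (hc.mul_right).add (hc.mul_left).mul_left
  have hdiv : ∀ x, ∑ i, partialDeriv i (F i) x
      = φ x * Laplacian.laplacian φ x * weight N δ x ^ (n + 1)
        + (∑ i, partialDeriv i φ x ^ 2) * weight N δ x ^ (n + 1)
        + ((n + 1) * (N * weight N δ x ^ (n + 2)
          - 2 * (n + 2) * (‖x‖ ^ 2 * weight N δ x ^ (n + 3)))) * φ x ^ 2 := by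
    intro x
    have : ∀ i, partialDeriv i (F i) x
        = φ x * weight N δ x ^ (n + 1) * partialDeriv i (partialDeriv i φ) x
        + weight N δ x ^ (n + 1) * partialDeriv i φ x ^ 2
        + ((n + 1) * (weight N δ x ^ (n + 2) * φ x ^ 2)
          - (n + 1) * (2 * (n + 2)) * weight N δ x ^ (n + 3) * φ x ^ 2 * x i ^ 2) := by
      intro i
      rw [hFdef]
      rw [partialDeriv_add i (hφ.mul ((contDiff_partialDeriv i hφ).mul (hw _)))
        ((contDiff_const.mul (hwx i)).mul (hφ.mul hφ)),
        partialDeriv_mul i hφ ((contDiff_partialDeriv i hφ).mul (hw _)),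
        partialDeriv_mul i (contDiff_partialDeriv i hφ) (hw _),
        partialDeriv_mul i (contDiff_const.mul (hwx i)) (hφ.mul hφ), partialDeriv_mul i hφ hφ,
        partialDeriv_const_mul i (hwx i),
        partialDeriv_mul i (contDiff_coord i) (hw _), partialDeriv_weight_pow hδ,
        partialDeriv_weight_pow hδ, partialDeriv_coord]
      push_cast
      ring
    simp only [this, Finset.sum_add_distrib, Finset.sum_sub_distrib, ← Finset.mul_sum,
      Finset.sum_const, Finset.card_univ, Fintype.card_fin, nsmul_eq_mul,
      EuclideanSpace.real_norm_sq_eq, laplacian_eq_sum_partialDeriv hφ]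
    ring
  have hint := integral_sum_partialDeriv_eq_zero hF hFc
  have hI := integrable_sum_partialDeriv hF hFc
  have h1 := integrable_sq_mul_weight_pow hδ (n + 2) hφ.continuous hc
  have h2 := integrable_gradSq_mul_weight_pow hδ (n + 1) hφ hc
  have h3 := integrable_sq_mul_weight_pow hδ n (contDiff_laplacian hφ).continuous
    (hasCompactSupport_laplacian hφ hc)
  have hardy := hardy_weight hδ (n + 1) (by omega) hφ hc
  -- The product φ Δφ is split by the square (4Δφ + σφ)²/2. The coefficient 1/2 on φ² is what allows
  -- that term to be absorbed by the Hardy inequality at exponent n + 1.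
  have key : ∫ x, (4 * ((∑ i, partialDeriv i φ x ^ 2) * weight N δ x ^ (n + 1)))
      ≤ ∫ x, (8 * (Laplacian.laplacian φ x ^ 2 * weight N δ x ^ n)
          + 2⁻¹ * (φ x ^ 2 * weight N δ x ^ (n + 2)) + 4 * ∑ i, partialDeriv i (F i) x) := by
    refine integral_mono (h2.const_mul 4)
      (((h3.const_mul 8).add (h1.const_mul 2⁻¹)).add (hI.const_mul 4)) fun x => ?_
    simp only
    rw [hdiv]
    have hσ := weight_pos (N := N) hδ x
    have hxσ := normSq_mul_weight_le (N := N) hδ x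
    set σ := weight N δ x
    set L := Laplacian.laplacian φ x
    have hNr : (2 * n + 5 : ℝ) ≤ N := by exact_mod_cast hN
    have hsn : 0 < σ ^ n := pow_pos hσ n
    have hA : 0 ≤ (n + 1) * (N * σ ^ (n + 2) - 2 * (n + 2) * (‖x‖ ^ 2 * σ ^ (n + 3))) := by
      have h5 : 0 < σ ^ (n + 2) := pow_pos hσ _
      have h6 : 2 * ((n : ℝ) + 2) * (‖x‖ ^ 2 * σ) ≤ 2 * (n + 2) * 1 := by gcongr
      have h7 : ‖x‖ ^ 2 * σ ^ (n + 3) = (‖x‖ ^ 2 * σ) * σ ^ (n + 2) := by ring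
      rw [h7]
      have : 0 ≤ (N - 2 * (n + 2) * (‖x‖ ^ 2 * σ)) * σ ^ (n + 2) :=
        mul_nonneg (by linarith) h5.le
      have h8 : (0:ℝ) ≤ n + 1 := by positivity
      refine mul_nonneg h8 ?_
      linarith
    have h4 := mul_nonneg hA (sq_nonneg (φ x))
    have h5 : 0 ≤ (8 * L ^ 2 + 2⁻¹ * (φ x ^ 2 * σ ^ 2) + 4 * (φ x * L * σ)) * σ ^ n :=
      mul_nonneg (by nlinarith [sq_nonneg (4 * L + φ x * σ)]) hsn.le
    have h6 : (8 * L ^ 2 + 2⁻¹ * (φ x ^ 2 * σ ^ 2) + 4 * (φ x * L * σ)) * σ ^ n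
      = 8 * (L ^ 2 * σ ^ n) + 2⁻¹ * (φ x ^ 2 * σ ^ (n + 2)) + 4 * (φ x * L * σ ^ (n + 1)) := by
      ring
    linarith
  rw [integral_add (f := fun x => 8 * (Laplacian.laplacian φ x ^ 2 * weight N δ x ^ n)
      + 2⁻¹ * (φ x ^ 2 * weight N δ x ^ (n + 2))) ((h3.const_mul 8).add (h1.const_mul 2⁻¹))
      (hI.const_mul 4), integral_add (h3.const_mul 8) (h1.const_mul 2⁻¹), integral_const_mul,
    integral_const_mul, integral_const_mul, integral_const_mul, hint] at key
  linarith

theorem contDiff_hasCompactSupport_laplacian_iterate (k : ℕ) (hφ : ContDiff ℝ ∞ φ)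
    (hc : HasCompactSupport φ) : ContDiff ℝ ∞ (Laplacian.laplacian^[k] φ) ∧
      HasCompactSupport (Laplacian.laplacian^[k] φ) := by
  induction k with
  | zero => exact ⟨hφ, hc⟩
  | succ k ih =>
    rw [Function.iterate_succ_apply']
    exact ⟨contDiff_laplacian ih.1, hasCompactSupport_laplacian ih.1 ih.2⟩

/-- Each Laplacian trades two powers of the weight for a factor 16. The dimension condition is that
of the first, most singular, application. -/
theorem rellich_iterate_weight (hδ : 0 < δ) (k n : ℕ) (hN : 2 * n + 4 * k + 1 ≤ N)
    (hφ : ContDiff ℝ ∞ φ) (hc : HasCompactSupport φ) :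
    ∫ x, φ x ^ 2 * weight N δ x ^ (n + 2 * k)
      ≤ 16 ^ k * ∫ x, Laplacian.laplacian^[k] φ x ^ 2 * weight N δ x ^ n := by
  induction k generalizing φ with
  | zero => simp
  | succ k ih =>
    have h1 := rellich_weight hδ (n + 2 * k) (by omega) hφ hc
    have h2 := ih (by omega) (contDiff_laplacian hφ) (hasCompactSupport_laplacian hφ hc)
    rw [← Function.iterate_succ_apply] at h2
    rw [pow_succ', mul_assoc]
    exact h1.trans (mul_le_mul_of_nonneg_left h2 (by norm_num))

/-- For m = 2k the weight is used up by k Rellich steps. For m = 2k + 1 one power is left over, and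
it is removed by the Hardy inequality applied to Δᵏφ. The constant 16^m is crude but uniform in the
parity. -/
theorem energy_ge (m : ℕ) (hm : 2 * m < N) (hδ : 0 < δ) (hφ : ContDiff ℝ ∞ φ)
    (hc : HasCompactSupport φ) :
    ∫ x, φ x ^ 2 * weight N δ x ^ m ≤ 16 ^ m * energy N m φ := by
  have mono : ∀ k ≤ m, ∀ {E : ℝ}, 0 ≤ E → (16 : ℝ) ^ k * E ≤ 16 ^ m * E := by
    intro k hk E hE
    gcongr
    norm_num
  unfold energy
  split_ifs with hodd
  · obtain ⟨k, rfl⟩ := hodd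
    have h0 : (2 * k + 1 - 1) / 2 = k := by omega
    rw [h0]
    simp only [norm_gradient_sq]
    have h1 := rellich_iterate_weight hδ k 1 (by omega) hφ hc
    obtain ⟨h2, h3⟩ := contDiff_hasCompactSupport_laplacian_iterate k hφ hc
    have h4 := hardy_weight hδ 0 (by omega) h2 h3
    simp only [zero_add, pow_zero, mul_one] at h4
    have hE : 0 ≤ ∫ x, ∑ i, partialDeriv i (Laplacian.laplacian^[k] φ) x ^ 2 :=
      integral_nonneg fun x => Finset.sum_nonneg fun i _ => sq_nonneg _
    calc _ = ∫ x, φ x ^ 2 * weight N δ x ^ (1 + 2 * k) := by rw [add_comm]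
      _ ≤ _ := h1
      _ ≤ 16 ^ k * (4 * ∫ x, ∑ i, partialDeriv i (Laplacian.laplacian^[k] φ) x ^ 2) := by gcongr
      _ ≤ 16 ^ k * (16 * ∫ x, ∑ i, partialDeriv i (Laplacian.laplacian^[k] φ) x ^ 2) := by
          gcongr; norm_num
      _ = 16 ^ (k + 1) * ∫ x, ∑ i, partialDeriv i (Laplacian.laplacian^[k] φ) x ^ 2 := by ring
      _ ≤ _ := mono _ (by omega) hE
  · obtain ⟨k, rfl⟩ := Nat.not_odd_iff_even.1 hodd
    have h0 : (k + k) / 2 = k := by omega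
    rw [h0]
    have h1 := rellich_iterate_weight hδ k 0 (by omega) hφ hc
    simp only [zero_add, pow_zero, mul_one] at h1
    rw [← two_mul]
    have hE : 0 ≤ ∫ x, Laplacian.laplacian^[k] φ x ^ 2 := integral_nonneg fun x => sq_nonneg _
    rw [← two_mul] at mono
    exact h1.trans (mono _ (by omega) hE)

/-- Stability for potentials below a small multiple of `(δ + |x|²)^{-m}`. -/
theorem energy_sub_nonneg (m : ℕ) (hm : 2 * m < N) (hδ : 0 < δ) {V : RN N → ℝ}
    (hV : Continuous V) (hVle : ∀ x, 16 ^ m * V x ≤ weight N δ x ^ m) (hφ : ContDiff ℝ ∞ φ)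
    (hc : HasCompactSupport φ) : 0 ≤ energy N m φ - ∫ x, V x * φ x ^ 2 := by
  have h1 := energy_ge m hm hδ hφ hc
  have hi : Integrable (fun x => V x * φ x ^ 2) := by
    refine Continuous.integrable_of_hasCompactSupport (hV.mul (hφ.continuous.pow 2)) ?_
    refine HasCompactSupport.mul_left ?_
    exact hc.comp_left (g := fun y : ℝ => y ^ 2) (by simp)
  have h2 : 16 ^ m * ∫ x, V x * φ x ^ 2 ≤ ∫ x, φ x ^ 2 * weight N δ x ^ m := by
    rw [← integral_const_mul]
    refine integral_mono (hi.const_mul _) (integrable_sq_mul_weight_pow hδ m hφ.continuous hc)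
      fun x => ?_
    have := mul_le_mul_of_nonneg_left (hVle x) (sq_nonneg (φ x))
    simp only
    linarith
  have h3 := le_of_mul_le_mul_left (h2.trans h1) (by positivity : (0:ℝ) < 16 ^ m)
  linarith

end Rellich
-- The radial Laplacian in t = r² and its inverse
/-- The weighted average `∫₀¹ pⁿ f(t p²) dp`. -/
noncomputable def avg (n : ℕ) (f : ℝ → ℝ) (t : ℝ) : ℝ := ∫ p in (0 : ℝ)..1, p ^ n * f (t * p ^ 2)

/-- The radial Laplacian in the variable `t = r²`. -/
noncomputable def sqLaplacian (N : ℕ) (g : ℝ → ℝ) (t : ℝ) : ℝ :=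
  4 * t * deriv (deriv g) t + 2 * N * deriv g t

/-- The right inverse of `sqLaplacian N` whose values vanish at `0`. -/
noncomputable def sqInv (N : ℕ) (f : ℝ → ℝ) (t : ℝ) : ℝ :=
  2⁻¹ * ∫ s in (0 : ℝ)..t, avg (N - 1) f s

section Avg

variable {f g : ℝ → ℝ} {n N : ℕ}

theorem intervalIntegrable_avg (hf : Continuous f) (n : ℕ) (t a b : ℝ) :
    IntervalIntegrable (fun p => p ^ n * f (t * p ^ 2)) volume a b :=
  Continuous.intervalIntegrable (by fun_prop) _ _

theorem continuous_avg (hf : Continuous f) (n : ℕ) : Continuous (avg n f) := by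
  unfold avg
  apply intervalIntegral.continuous_parametric_intervalIntegral_of_continuous'
  fun_prop

theorem hasDerivAt_avg (hf : ContDiff ℝ 1 f) (n : ℕ) (t : ℝ) :
    HasDerivAt (avg n f) (avg (n + 2) (deriv f) t) t := by
  have hf' : Continuous (deriv f) := hf.continuous_deriv (le_refl _)
  have hfc := hf.continuous
  have hcont : Continuous (fun q : ℝ × ℝ => q.2 ^ (n + 2) * deriv f (q.1 * q.2 ^ 2)) := by fun_prop
  obtain ⟨C, hC⟩ := ((isCompact_closedBall t 1).prod
    (isCompact_uIcc (a := (0:ℝ)) (b := 1))).exists_bound_of_continuousOn hcont.continuousOn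
  refine (intervalIntegral.hasDerivAt_integral_of_dominated_loc_of_deriv_le
    (F := fun t p => p ^ n * f (t * p ^ 2))
    (F' := fun t p => p ^ (n + 2) * deriv f (t * p ^ 2)) (bound := fun _ => C)
    (Metric.ball_mem_nhds t one_pos) ?_ ?_ ?_ ?_ ?_ ?_).2
  · exact Eventually.of_forall fun x => Continuous.aestronglyMeasurable (by fun_prop)
  · exact intervalIntegrable_avg hfc n t 0 1
  · exact Continuous.aestronglyMeasurable (by fun_prop)
  · refine Eventually.of_forall fun p hp x hx => hC (x, p) ⟨Metric.ball_subset_closedBall hx, ?_⟩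
    exact uIoc_subset_uIcc hp
  · simp
  · refine Eventually.of_forall fun p hp x hx => ?_
    have h1 : HasDerivAt f (deriv f (x * p ^ 2)) (x * p ^ 2) :=
      ((hf.differentiable (by simp)) _).hasDerivAt
    have h2 : HasDerivAt (fun x : ℝ => x * p ^ 2) (p ^ 2) x := by
      simpa using (hasDerivAt_id x).mul_const (p ^ 2)
    refine ((h1.comp x h2).const_mul (p ^ n)).congr_deriv ?_
    ring

theorem contDiff_avg (k : ℕ) (hf : ContDiff ℝ k f) (n : ℕ) : ContDiff ℝ k (avg n f) := by
  induction k generalizing f n with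
  | zero =>
    simp only [Nat.cast_zero, contDiff_zero] at hf ⊢
    exact continuous_avg hf n
  | succ k ih =>
    push_cast at hf ⊢
    have h1 : ContDiff ℝ 1 f := hf.of_le (by simp)
    have h2 := contDiff_succ_iff_deriv.1 hf
    refine contDiff_succ_iff_deriv.2 ⟨fun t => (hasDerivAt_avg h1 n t).differentiableAt, by simp, ?_⟩
    have : deriv (avg n f) = avg (n + 2) (deriv f) := funext fun t => (hasDerivAt_avg h1 n t).deriv
    rw [this]
    exact ih h2.2.2 _

theorem avg_mono {T : ℝ} (hf : Continuous f) (hg : Continuous g)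
    (h : ∀ t ∈ Icc 0 T, f t ≤ g t) (n : ℕ) : ∀ t ∈ Icc 0 T, avg n f t ≤ avg n g t := by
  intro t ht
  refine intervalIntegral.integral_mono_on zero_le_one (intervalIntegrable_avg hf n t 0 1)
    (intervalIntegrable_avg hg n t 0 1) fun p hp => ?_
  have hp2 : p ^ 2 ≤ 1 := pow_le_one₀ hp.1 hp.2
  refine mul_le_mul_of_nonneg_left (h _ ⟨mul_nonneg ht.1 (sq_nonneg p), ?_⟩) (pow_nonneg hp.1 n)
  nlinarith [ht.1, ht.2]

theorem hasDerivAt_sqInv (hf : Continuous f) (t : ℝ) :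
    HasDerivAt (sqInv N f) (2⁻¹ * avg (N - 1) f t) t :=
  ((continuous_avg hf (N - 1)).integral_hasStrictDerivAt 0 t).hasDerivAt.const_mul _

theorem deriv_sqInv (hf : Continuous f) : deriv (sqInv N f) = fun t => 2⁻¹ * avg (N - 1) f t :=
  funext fun t => (hasDerivAt_sqInv hf t).deriv

/-- The derivative is an average of `f`, hence as smooth as `f`. This gain of one derivative drives
the bootstrap in `contDiff_of_eq_sqSolve`. -/
theorem contDiff_sqInv (k : ℕ) (hf : ContDiff ℝ k f) :
    ContDiff ℝ ((k + 1 : ℕ) : ℕ∞) (sqInv N f) := by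
  push_cast
  refine contDiff_succ_iff_deriv.2
    ⟨fun t => (hasDerivAt_sqInv hf.continuous t).differentiableAt, by simp, ?_⟩
  rw [deriv_sqInv hf.continuous]
  exact contDiff_const.mul (contDiff_avg k hf _)

theorem continuous_sqInv (hf : Continuous f) : Continuous (sqInv N f) :=
  (contDiff_sqInv 0 (by simpa using hf)).continuous

theorem sqInv_zero (f : ℝ → ℝ) : sqInv N f 0 = 0 := by simp [sqInv]

/-- Differentiating under the integral turns the left side into ∫₀¹ d/dp [p^N f(t p²)] dp. The
boundary term at p = 0 vanishes because N ≥ 1. -/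
theorem sqLaplacian_sqInv (hN : 1 ≤ N) (hf : ContDiff ℝ 1 f) :
    sqLaplacian N (sqInv N f) = f := by
  funext t
  have hfc := hf.continuous
  have hf' : Continuous (deriv f) := hf.continuous_deriv (le_refl _)
  have h1 : deriv (deriv (sqInv N f)) t = 2⁻¹ * avg (N - 1 + 2) (deriv f) t := by
    rw [deriv_sqInv hf.continuous]
    exact ((hasDerivAt_avg hf (N - 1) t).const_mul _).deriv
  have h2 : ∫ p in (0:ℝ)..1, (2 * t * (p ^ (N - 1 + 2) * deriv f (t * p ^ 2))
      + N * (p ^ (N - 1) * f (t * p ^ 2))) = f t := by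
    have : ∀ p ∈ uIcc (0:ℝ) 1, HasDerivAt (fun p => p ^ N * f (t * p ^ 2))
      (2 * t * (p ^ (N - 1 + 2) * deriv f (t * p ^ 2)) + N * (p ^ (N - 1) * f (t * p ^ 2))) p := by
      intro p _
      have h3 : HasDerivAt f (deriv f (t * p ^ 2)) (t * p ^ 2) :=
        ((hf.differentiable (by simp)) _).hasDerivAt
      have h4 : HasDerivAt (fun p : ℝ => t * p ^ 2) (t * (2 * p)) p := by
        simpa using (hasDerivAt_pow 2 p).const_mul t
      refine ((hasDerivAt_pow N p).mul (h3.comp p h4)).congr_deriv ?_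
      obtain ⟨k, rfl⟩ := Nat.exists_eq_add_of_le' hN
      simp only [Nat.add_sub_cancel, Function.comp]
      ring
    rw [intervalIntegral.integral_eq_sub_of_hasDerivAt this
      (Continuous.intervalIntegrable (by fun_prop) _ _)]
    have : (0:ℝ) ^ N = 0 := zero_pow (by omega)
    simp [this]
  rw [intervalIntegral.integral_add (Continuous.intervalIntegrable (by fun_prop) _ _)
    (Continuous.intervalIntegrable (by fun_prop) _ _), intervalIntegral.integral_const_mul,
    intervalIntegral.integral_const_mul] at h2
  simp only [sqLaplacian, h1]
  rw [deriv_sqInv hf.continuous]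
  simp only [avg] at h2 ⊢
  linarith

theorem sqInv_mono {T : ℝ} (hf : Continuous f) (hg : Continuous g)
    (h : ∀ t ∈ Icc 0 T, f t ≤ g t) : ∀ t ∈ Icc 0 T, sqInv N f t ≤ sqInv N g t := by
  intro t ht
  refine mul_le_mul_of_nonneg_left ?_ (by norm_num)
  refine intervalIntegral.integral_mono_on ht.1 ((continuous_avg hf _).intervalIntegrable _ _)
    ((continuous_avg hg _).intervalIntegrable _ _) fun s hs => ?_
  exact avg_mono hf hg h _ s ⟨hs.1, hs.2.trans ht.2⟩

theorem sqInv_add (hf : Continuous f) (hg : Continuous g) (t : ℝ) :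
    sqInv N (fun s => f s + g s) t = sqInv N f t + sqInv N g t := by
  have : avg (N - 1) (fun s => f s + g s) = fun s => avg (N - 1) f s + avg (N - 1) g s := by
    funext s
    simp only [avg, mul_add]
    exact intervalIntegral.integral_add (intervalIntegrable_avg hf _ s 0 1)
      (intervalIntegrable_avg hg _ s 0 1)
  simp only [sqInv, this]
  rw [intervalIntegral.integral_add ((continuous_avg hf _).intervalIntegrable _ _)
    ((continuous_avg hg _).intervalIntegrable _ _), mul_add]

theorem sqInv_const_mul (c : ℝ) (f : ℝ → ℝ) (t : ℝ) :
    sqInv N (fun s => c * f s) t = c * sqInv N f t := by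
  have : avg (N - 1) (fun s => c * f s) = fun s => c * avg (N - 1) f s := by
    funext s
    simp only [avg, ← intervalIntegral.integral_const_mul]
    congr 1; funext p; ring
  simp only [sqInv, this, intervalIntegral.integral_const_mul]
  ring

theorem sqInv_pow (hN : 1 ≤ N) (k : ℕ) (t : ℝ) :
    sqInv N (fun s => s ^ k) t = (2 * (k + 1) * (N + 2 * k) : ℝ)⁻¹ * t ^ (k + 1) := by
  have : avg (N - 1) (fun s => s ^ k) = fun s => (N + 2 * k : ℝ)⁻¹ * s ^ k := by
    funext s
    have : ∀ p : ℝ, p ^ (N - 1) * (s * p ^ 2) ^ k = s ^ k * p ^ (N - 1 + 2 * k) := by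
      intro p; ring
    simp only [avg, this, intervalIntegral.integral_const_mul, integral_pow]
    obtain ⟨l, rfl⟩ := Nat.exists_eq_add_of_le' hN
    push_cast [Nat.add_sub_cancel]
    have : (0:ℝ) < l + 1 + 2 * k := by positivity
    simp
    field_simp
    ring
  simp only [sqInv, this, intervalIntegral.integral_const_mul, integral_pow]
  have : (0:ℝ) < N + 2 * k := by positivity
  simp
  field_simp

/-- Averaging over p ∈ [0, 1] preserves the bound because |t p²| ≤ |t|, and integrating the
exponential gains 1/l. A large l thus makes the nonlinear map contractive on the whole line. -/
theorem abs_sqInv_le {C l : ℝ} (hl : 1 ≤ l) (hC : 0 ≤ C)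
    (h : ∀ t, |f t| ≤ C * Real.exp (l * |t|)) (t : ℝ) :
    |sqInv N f t| ≤ C / (2 * l) * Real.exp (l * |t|) := by
  have hl0 : 0 < l := by linarith
  have h1 : ∀ s, |avg (N - 1) f s| ≤ C * Real.exp (l * |s|) := by
    intro s
    have := intervalIntegral.norm_integral_le_of_norm_le_const (a := (0:ℝ)) (b := 1)
      (f := fun p => p ^ (N - 1) * f (s * p ^ 2)) (C := C * Real.exp (l * |s|)) (by
        intro p hp
        rw [uIoc_of_le zero_le_one] at hp
        have hp2 : p ^ 2 ≤ 1 := pow_le_one₀ hp.1.le hp.2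
        have hp1 : |p ^ (N - 1)| ≤ 1 := by
          rw [abs_of_nonneg (pow_nonneg hp.1.le _)]; exact pow_le_one₀ hp.1.le hp.2
        rw [norm_mul, Real.norm_eq_abs, Real.norm_eq_abs]
        calc |p ^ (N - 1)| * |f (s * p ^ 2)| ≤ 1 * |f (s * p ^ 2)| := by gcongr
          _ ≤ C * Real.exp (l * |s * p ^ 2|) := by rw [one_mul]; exact h _
          _ ≤ C * Real.exp (l * |s|) := by
            have : |s * p ^ 2| ≤ |s| := by
              rw [abs_mul, abs_of_nonneg (sq_nonneg p)]
              exact mul_le_of_le_one_right (abs_nonneg s) hp2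
            gcongr)
    simpa [avg] using this
  have h2 : |∫ s in (0:ℝ)..t, avg (N - 1) f s| ≤ C / l * Real.exp (l * |t|) := by
    rcases le_total 0 t with ht | ht
    · have h3 := intervalIntegral.norm_integral_le_of_norm_le (μ := volume) (a := 0) (b := t)
        (f := avg (N - 1) f) (g := fun s => C * Real.exp (l * s)) ht
        (Eventually.of_forall fun s hs => by
          have := h1 s
          rwa [abs_of_pos hs.1] at this)
        (Continuous.intervalIntegrable (by fun_prop) _ _)
      have h4 : ∫ s in (0:ℝ)..t, C * Real.exp (l * s) = C / l * Real.exp (l * t) - C / l := by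
        have := intervalIntegral.integral_eq_sub_of_hasDerivAt (a := 0) (b := t)
          (f := fun s => C / l * Real.exp (l * s)) (f' := fun s => C * Real.exp (l * s))
          (fun s _ => by
            have := (((hasDerivAt_id s).const_mul l).exp).const_mul (C / l)
            refine this.congr_deriv ?_
            simp; field_simp)
          (Continuous.intervalIntegrable (by fun_prop) _ _)
        simpa using this
      rw [h4, Real.norm_eq_abs] at h3
      rw [abs_of_nonneg ht]
      have : 0 ≤ C / l := by positivity
      linarith
    · have h3 := intervalIntegral.norm_integral_le_of_norm_le (μ := volume) (a := t) (b := 0)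
        (f := avg (N - 1) f) (g := fun s => C * Real.exp (l * (-s))) ht
        (Eventually.of_forall fun s hs => by
          have := h1 s
          rwa [abs_of_nonpos hs.2] at this)
        (Continuous.intervalIntegrable (by fun_prop) _ _)
      have h4 : ∫ s in t..0, C * Real.exp (l * (-s)) = C / l * Real.exp (l * (-t)) - C / l := by
        have := intervalIntegral.integral_eq_sub_of_hasDerivAt (a := t) (b := 0)
          (f := fun s => -(C / l * Real.exp (l * (-s)))) (f' := fun s => C * Real.exp (l * (-s)))
          (fun s _ => by
            have := ((((hasDerivAt_id s).neg).const_mul l).exp).const_mul (C / l)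
            refine this.neg.congr_deriv ?_
            simp; field_simp)
          (Continuous.intervalIntegrable (by fun_prop) _ _)
        rw [this]; simp; ring
      rw [h4, Real.norm_eq_abs] at h3
      rw [abs_of_nonpos ht, intervalIntegral.integral_symm, abs_neg]
      have : 0 ≤ C / l := by positivity
      linarith
  rw [sqInv, abs_mul, abs_of_pos (by norm_num : (0:ℝ) < 2⁻¹)]
  calc 2⁻¹ * |∫ s in (0:ℝ)..t, avg (N - 1) f s| ≤ 2⁻¹ * (C / l * Real.exp (l * |t|)) := by gcongr
    _ = _ := by field_simp

/-- Functions that decay like `(1 + t)⁻²` have a bounded inverse Laplacian. -/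
theorem sqInv_le_of_decay (hN : 5 ≤ N) {C T : ℝ} (hC : 0 ≤ C) (hf : Continuous f)
    (h : ∀ t ∈ Icc 0 T, f t ≤ C * ((1 + t) ^ 2)⁻¹) : ∀ t ∈ Icc 0 T, sqInv N f t ≤ C / 2 := by
  intro t ht
  have h1 : ∀ s ∈ Icc 0 T, avg (N - 1) f s ≤ C * ((1 + s) ^ 2)⁻¹ := by
    intro s hs
    have : avg (N - 1) f s ≤ ∫ p in (0:ℝ)..1, C * ((1 + s) ^ 2)⁻¹ := by
      refine intervalIntegral.integral_mono_on zero_le_one (intervalIntegrable_avg hf _ s 0 1)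
        (by simp) fun p hp => ?_
      have hs0 := hs.1
      have hp2 : p ^ 2 ≤ 1 := pow_le_one₀ hp.1 hp.2
      have hsp : 0 ≤ s * p ^ 2 := mul_nonneg hs0 (sq_nonneg p)
      have h2 := h (s * p ^ 2) ⟨hsp, by nlinarith [hs.2]⟩
      -- Here N ≥ 5 enters: since p²(1 + s) ≤ 1 + s p², the factor p⁴ compensates the loss of decay
      -- at s p², so the average decays like `f` itself.
      have h3 : p ^ (N - 1) ≤ p ^ 4 := pow_le_pow_of_le_one hp.1 hp.2 (by omega)
      have h4 : p ^ 4 * ((1 + s * p ^ 2) ^ 2)⁻¹ ≤ ((1 + s) ^ 2)⁻¹ := by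
        rw [← div_eq_mul_inv, ← one_div, div_le_div_iff₀ (by positivity) (by positivity)]
        have : p ^ 2 * (1 + s) ≤ 1 + s * p ^ 2 := by nlinarith
        calc p ^ 4 * (1 + s) ^ 2 = (p ^ 2 * (1 + s)) ^ 2 := by ring
          _ ≤ (1 + s * p ^ 2) ^ 2 := by gcongr
          _ = _ := by ring
      calc p ^ (N - 1) * f (s * p ^ 2) ≤ p ^ (N - 1) * (C * ((1 + s * p ^ 2) ^ 2)⁻¹) :=
            mul_le_mul_of_nonneg_left h2 (pow_nonneg hp.1 _)
        _ ≤ p ^ 4 * (C * ((1 + s * p ^ 2) ^ 2)⁻¹) := by gcongr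
        _ = C * (p ^ 4 * ((1 + s * p ^ 2) ^ 2)⁻¹) := by ring
        _ ≤ _ := by gcongr
    simpa using this
  have hne : ∀ s ∈ Icc 0 t, (1 + s) ≠ 0 := fun s hs => by have := hs.1; positivity
  have hint : IntervalIntegrable (fun s : ℝ => C * ((1 + s) ^ 2)⁻¹) volume 0 t := by
    refine ContinuousOn.intervalIntegrable ?_
    rw [uIcc_of_le ht.1]
    refine continuousOn_const.mul (ContinuousOn.inv₀ (by fun_prop) fun s hs => ?_)
    exact pow_ne_zero 2 (hne s hs)
  have h5 := intervalIntegral.integral_mono_on ht.1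
    ((continuous_avg hf (N - 1)).intervalIntegrable 0 t) hint
    (fun s hs => h1 s ⟨hs.1, hs.2.trans ht.2⟩)
  have h6 : ∫ s in (0:ℝ)..t, C * ((1 + s) ^ 2)⁻¹ = C - C * (1 + t)⁻¹ := by
    rw [intervalIntegral.integral_eq_sub_of_hasDerivAt (f := fun s => -(C * (1 + s)⁻¹)) _ hint]
    · simp; ring
    · intro s hs
      rw [uIcc_of_le ht.1] at hs
      have := ((((hasDerivAt_id s).const_add 1).inv (hne s hs)).const_mul C).neg
      refine this.congr_deriv ?_
      simp; field_simp
  rw [h6] at h5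
  have h7 : 0 ≤ C * (1 + t)⁻¹ := by have := ht.1; positivity
  rw [sqInv]
  linarith

end Avg
-- Iterated inversion with prescribed data at the origin
/-- The function `w` with `Δⁿ w = f` and `Δᵏ w(0) = α k` for `k < n`, where `Δ = sqLaplacian N`. -/
noncomputable def sqSolve (N : ℕ) : (ℕ → ℝ) → ℕ → (ℝ → ℝ) → ℝ → ℝ
  | _, 0, f => f
  | α, n + 1, f => fun t => α 0 + sqInv N (sqSolve N (fun k => α (k + 1)) n f) t

section Solve

variable {N : ℕ} {f g : ℝ → ℝ}

theorem contDiff_sqSolve (k : ℕ) (hf : ContDiff ℝ k f) (α : ℕ → ℝ) (n : ℕ) :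
    ContDiff ℝ k (sqSolve N α n f) := by
  induction n generalizing α with
  | zero => exact hf
  | succ n ih =>
    refine contDiff_const.add ((contDiff_sqInv k (ih _)).of_le ?_)
    exact_mod_cast Nat.le_succ k

theorem continuous_sqSolve (hf : Continuous f) (α : ℕ → ℝ) (n : ℕ) :
    Continuous (sqSolve N α n f) :=
  (contDiff_sqSolve 0 (by simpa using hf) α n).continuous

theorem sqLaplacian_const_add (c : ℝ) (f : ℝ → ℝ) :
    sqLaplacian N (fun t => c + f t) = sqLaplacian N f := by
  have : deriv (fun t => c + f t) = deriv f := funext fun t => deriv_const_add c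
  funext t
  simp only [sqLaplacian, this]

theorem iterate_sqLaplacian_sqSolve (hN : 1 ≤ N) (hf : ContDiff ℝ 1 f) (α : ℕ → ℝ) (n k : ℕ) :
    (sqLaplacian N)^[k] (sqSolve N α (k + n) f) = sqSolve N (fun j => α (j + k)) n f := by
  induction k generalizing α with
  | zero => simp
  | succ k ih =>
    have h1 : sqLaplacian N (sqSolve N α (k + 1 + n) f)
        = sqSolve N (fun j => α (j + 1)) (k + n) f := by
      have h2 : k + 1 + n = (k + n) + 1 := by ring
      rw [h2, sqSolve, sqLaplacian_const_add]
      exact sqLaplacian_sqInv hN (contDiff_sqSolve 1 hf _ _)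
    rw [Function.iterate_succ_apply, h1, ih]
    congr 1

/-- The integral kernels are positive and only use values on [0, t], so order passes through all n
layers. This plays the role of a maximum principle for the higher-order operator. -/
theorem sqSolve_mono {T : ℝ} (hf : Continuous f) (hg : Continuous g)
    (h : ∀ t ∈ Icc 0 T, f t ≤ g t) (α : ℕ → ℝ) (n : ℕ) :
    ∀ t ∈ Icc 0 T, sqSolve N α n f t ≤ sqSolve N α n g t := by
  induction n generalizing α with
  | zero => exact h
  | succ n ih =>
    intro t ht
    have := sqInv_mono (N := N) (continuous_sqSolve hf _ _) (continuous_sqSolve hg _ _)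
      (ih (fun k => α (k + 1))) t ht
    simp only [sqSolve]
    linarith

theorem sqInv_sub (hf : Continuous f) (hg : Continuous g) (t : ℝ) :
    sqInv N f t - sqInv N g t = sqInv N (fun s => f s - g s) t := by
  have h1 := sqInv_add (N := N) hf (hg.const_mul (-1)) t
  rw [sqInv_const_mul] at h1
  simp only [neg_mul, one_mul, ← sub_eq_add_neg] at h1
  exact h1.symm

/-- The data cancel in the difference, and every layer multiplies the constant by 1/(2l) ≤ 1. -/
theorem abs_sqSolve_sub_le {C l : ℝ} (hl : 1 ≤ l) (hC : 0 ≤ C) (hf : Continuous f)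
    (hg : Continuous g) (h : ∀ t, |f t - g t| ≤ C * Real.exp (l * |t|)) (α : ℕ → ℝ) (n : ℕ)
    (t : ℝ) : |sqSolve N α n f t - sqSolve N α n g t| ≤ C * Real.exp (l * |t|) := by
  induction n generalizing α t with
  | zero => exact h t
  | succ n ih =>
    simp only [sqSolve, add_sub_add_left_eq_sub]
    rw [sqInv_sub (continuous_sqSolve hf _ _) (continuous_sqSolve hg _ _)]
    refine (abs_sqInv_le hl hC (fun s => ih (fun k => α (k + 1)) s) t).trans ?_
    gcongr
    exact div_le_self hC (by linarith)

theorem sqInv_sum_pow (hN : 1 ≤ N) (K : ℝ) (n : ℕ) (t : ℝ) :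
    sqInv N (fun s => K * ∑ k ∈ Finset.range n, s ^ k) t
      = K * ∑ k ∈ Finset.range n, (2 * (k + 1) * (N + 2 * k) : ℝ)⁻¹ * t ^ (k + 1) := by
  rw [sqInv_const_mul]
  congr 1
  induction n with
  | zero => simpa using sqInv_const_mul (N := N) 0 (fun _ => 0) t
  | succ n ih =>
    simp only [Finset.sum_range_succ]
    rw [sqInv_add (by fun_prop) (by fun_prop), ih, sqInv_pow hN]

/-- With a constant source the solution is a polynomial in which `b` enters only the top
coefficient, with a positive factor. It matters that `K` and `c` do not depend on `b`. -/
theorem exists_sqSolve_const_le (hN : 1 ≤ N) (α : ℕ → ℝ) (n : ℕ) :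
    ∃ K c : ℝ, 0 ≤ K ∧ 0 < c ∧ ∀ b t : ℝ, 0 ≤ t →
      sqSolve N α n (fun _ => b) t ≤ K * ∑ k ∈ Finset.range n, t ^ k + b * c * t ^ n := by
  induction n generalizing α with
  | zero => exact ⟨0, 1, le_rfl, one_pos, by intro b t _; simp [sqSolve]⟩
  | succ n ih =>
    obtain ⟨K, c, hK, hc, h⟩ := ih (fun k => α (k + 1))
    have hN0 : (1:ℝ) ≤ N := by exact_mod_cast hN
    have hd : ∀ k : ℕ, (1:ℝ) ≤ 2 * (k + 1) * (N + 2 * k) := by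
      intro k
      have : (0:ℝ) ≤ k := by positivity
      nlinarith
    refine ⟨max K |α 0|, c * (2 * (n + 1) * (N + 2 * n) : ℝ)⁻¹, hK.trans (le_max_left _ _), ?_, ?_⟩
    · have := hd n
      positivity
    · intro b t ht
      have h1 := sqInv_mono (N := N) (T := t)
        (continuous_sqSolve (N := N) (continuous_const (y := b)) (fun k => α (k + 1)) n)
        (by fun_prop : Continuous fun s => K * ∑ k ∈ Finset.range n, s ^ k + b * c * s ^ n)
        (fun s hs => h b s hs.1) t ⟨ht, le_rfl⟩
      rw [sqInv_add (by fun_prop) (by fun_prop), sqInv_sum_pow hN, sqInv_const_mul,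
        sqInv_pow hN] at h1
      have h2 : ∑ k ∈ Finset.range n, (2 * (k + 1) * (N + 2 * k) : ℝ)⁻¹ * t ^ (k + 1)
          ≤ ∑ k ∈ Finset.range n, t ^ (k + 1) := by
        refine Finset.sum_le_sum fun k _ => mul_le_of_le_one_left (by positivity) ?_
        exact inv_le_one_of_one_le₀ (hd k)
      have h3 : 0 ≤ ∑ k ∈ Finset.range n, t ^ (k + 1) := Finset.sum_nonneg fun k _ => by positivity
      rw [Finset.sum_range_succ', pow_zero]
      simp only [sqSolve]
      have h4 : K * ∑ k ∈ Finset.range n, (2 * (k + 1) * (N + 2 * k) : ℝ)⁻¹ * t ^ (k + 1)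
          ≤ max K |α 0| * ∑ k ∈ Finset.range n, t ^ (k + 1) :=
        mul_le_mul (le_max_left _ _) h2 (Finset.sum_nonneg fun k _ => by have := hd k; positivity)
          (hK.trans (le_max_left _ _))
      have h5 : α 0 ≤ max K |α 0| := (le_abs_self _).trans (le_max_right _ _)
      nlinarith [h1, h4, h5]

/-! ### Existence for the truncated equation -/

/-- Solvability of the truncated problem on the whole line. -/
theorem exists_truncated_solution {h : ℝ → ℝ} {H K ε : ℝ} (hh : Continuous h)
    (hH : ∀ x, |h x| ≤ H) (hK0 : 0 ≤ K) (hK : ∀ x y, |h x - h y| ≤ K * |x - y|) (hε : |ε| = 1)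
    (α : ℕ → ℝ) (n : ℕ) (b : ℝ) : ∃ g : ℝ → ℝ, Continuous g ∧
      g = sqSolve N α n (fun t => b + ε * sqInv N (fun s => h (g s)) t) := by
  -- In the norm with weight e^{l|t|} the contraction factor is K/(2l) ≤ 1/2.
  set l := K + 1 with hldef
  have hl : 1 ≤ l := by linarith
  have hl0 : 0 < l := by linarith
  have hH0 : 0 ≤ H := (abs_nonneg _).trans (hH 0)
  set w : ℝ → ℝ := fun t => Real.exp (l * |t|) with hw
  have hwc : Continuous w := by fun_prop
  have hwpos : ∀ t, 0 < w t := fun t => Real.exp_pos _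
  have hw1 : ∀ t, 1 ≤ w t := fun t => Real.one_le_exp (by positivity)
  set g₀ := sqSolve N α n (fun _ => b)
  have hg₀ : Continuous g₀ := continuous_sqSolve continuous_const _ _
  set Φ : (ℝ → ℝ) → ℝ → ℝ := fun g => sqSolve N α n (fun t => b + ε * sqInv N (fun s => h (g s)) t)
    with hΦ
  have hFc : ∀ g : ℝ → ℝ, Continuous g →
      Continuous (fun t => b + ε * sqInv N (fun s => h (g s)) t) := fun g hg =>
    continuous_const.add (continuous_const.mul (continuous_sqInv (hh.comp hg)))
  have hΦc : ∀ g, Continuous g → Continuous (Φ g) := fun g hg => continuous_sqSolve (hFc g hg) _ _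
  have hΦ0 : ∀ g, Continuous g → ∀ t, |Φ g t - g₀ t| ≤ H * w t := by
    intro g hg t
    refine abs_sqSolve_sub_le hl hH0 (hFc g hg) continuous_const (fun s => ?_) α n t
    rw [add_sub_cancel_left, abs_mul, hε, one_mul]
    refine (abs_sqInv_le hl hH0 (fun r => (hH _).trans ?_) s).trans ?_
    · exact le_mul_of_one_le_right hH0 (hw1 r)
    · gcongr
      exact div_le_self hH0 (by linarith)
  have hΦl : ∀ g g', Continuous g → Continuous g' → ∀ D, 0 ≤ D → (∀ t, |g t - g' t| ≤ D * w t) →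
      ∀ t, |Φ g t - Φ g' t| ≤ (1 / 2 * D) * w t := by
    intro g g' hg hg' D hD hgg t
    refine abs_sqSolve_sub_le hl (by positivity) (hFc g hg) (hFc g' hg') (fun s => ?_) α n t
    rw [add_sub_add_left_eq_sub, ← mul_sub, abs_mul, hε, one_mul,
      sqInv_sub (f := fun s => h (g s)) (g := fun s => h (g' s)) (hh.comp hg) (hh.comp hg')]
    refine (abs_sqInv_le hl (mul_nonneg hK0 hD) (fun r => (hK _ _).trans ?_) s).trans ?_
    · rw [mul_assoc]
      exact mul_le_mul_of_nonneg_left (hgg r) hK0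
    · gcongr
      rw [div_le_iff₀ (by positivity)]
      nlinarith
  -- The unknown is rescaled to a bounded continuous `v`, so that Banach's theorem applies in a
  -- complete space. The bound `hΦ0` shows that the rescaled map stays in it, although `g₀` itself
  -- need not be bounded by `w`.
  let lift : BoundedContinuousFunction ℝ ℝ → ℝ → ℝ := fun v t => g₀ t + w t * v t
  have hlc : ∀ v, Continuous (lift v) := fun v => hg₀.add (hwc.mul v.continuous)
  let Ψ : BoundedContinuousFunction ℝ ℝ → BoundedContinuousFunction ℝ ℝ := fun v =>
    BoundedContinuousFunction.ofNormedAddCommGroup (fun t => (w t)⁻¹ * (Φ (lift v) t - g₀ t))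
      ((hwc.inv₀ fun t => (hwpos t).ne').mul ((hΦc _ (hlc v)).sub hg₀)) H (fun t => by
        rw [Real.norm_eq_abs, abs_mul, abs_inv, abs_of_pos (hwpos t), inv_mul_le_iff₀ (hwpos t),
          mul_comm]
        exact hΦ0 _ (hlc v) t)
  have hΨ : ContractingWith (1 / 2) Ψ := by
    refine ⟨by rw [← NNReal.coe_lt_coe]; norm_num, LipschitzWith.of_dist_le_mul fun v v' => ?_⟩
    refine (BoundedContinuousFunction.dist_le (by positivity)).2 fun t => ?_
    have h1 := hΦl (lift v) (lift v') (hlc v) (hlc v') (dist v v') dist_nonneg (fun s => by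
      have : lift v s - lift v' s = w s * (v s - v' s) := by simp only [lift]; ring
      rw [this, abs_mul, abs_of_pos (hwpos s), mul_comm]
      refine mul_le_mul_of_nonneg_right ?_ (hwpos s).le
      exact BoundedContinuousFunction.dist_coe_le_dist (f := v) (g := v') s) t
    have h2 : (Ψ v) t - (Ψ v') t = (w t)⁻¹ * (Φ (lift v) t - Φ (lift v') t) := by
      change (w t)⁻¹ * (Φ (lift v) t - g₀ t) - (w t)⁻¹ * (Φ (lift v') t - g₀ t) = _
      ring
    rw [Real.dist_eq, h2, abs_mul, abs_inv, abs_of_pos (hwpos t), inv_mul_le_iff₀ (hwpos t),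
      mul_comm]
    simpa using h1
  obtain ⟨v, hv⟩ : ∃ v, Ψ v = v := ⟨_, hΨ.fixedPoint_isFixedPt⟩
  refine ⟨lift v, hlc v, funext fun t => ?_⟩
  have h1 : (w t)⁻¹ * (Φ (lift v) t - g₀ t) = v t := DFunLike.congr_fun hv t
  have h2 : Φ (lift v) t - g₀ t = w t * v t := by
    rw [← h1, mul_inv_cancel_left₀ (hwpos t).ne']
  change g₀ t + w t * v t = Φ (lift v) t
  linarith

theorem contDiff_of_eq_sqSolve {h : ℝ → ℝ} (hh : ContDiff ℝ ∞ h) (hg : Continuous g)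
    {ε b : ℝ} {α : ℕ → ℝ} {n : ℕ}
    (heq : g = sqSolve N α n (fun t => b + ε * sqInv N (fun s => h (g s)) t)) :
    ContDiff ℝ ∞ g := by
  refine contDiff_infty.2 fun k => ?_
  induction k with
  | zero => simpa using hg
  | succ k ih =>
    rw [heq]
    refine contDiff_sqSolve _ (contDiff_const.add (contDiff_const.mul ?_)) _ _
    exact contDiff_sqInv k ((contDiff_infty.1 hh k).comp ih)

/-- Multiplying exp by a smooth cutoff makes it bounded and globally Lipschitz, as the contraction
requires, while keeping it nonnegative and below exp, as the comparison requires. -/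
theorem exists_truncated_exp (M : ℝ) : ∃ h : ℝ → ℝ, ContDiff ℝ ∞ h ∧ (∀ y ≤ M, h y = Real.exp y) ∧
    (∀ y, 0 ≤ h y) ∧ (∀ y, h y ≤ Real.exp y) ∧ (∃ H, ∀ y, |h y| ≤ H) ∧
    ∃ K, 0 ≤ K ∧ ∀ x y, |h x - h y| ≤ K * |x - y| := by
  set h : ℝ → ℝ := fun y => Real.exp y * Real.smoothTransition (M + 1 - y) with hdef
  have hs : ContDiff ℝ ∞ h :=
    Real.contDiff_exp.mul (Real.smoothTransition.contDiff.comp (contDiff_const.sub contDiff_id))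
  have h1 : ∀ y ≤ M, h y = Real.exp y := fun y hy => by
    simp only [hdef]
    rw [Real.smoothTransition.one_of_one_le (by linarith), mul_one]
  have h0 : ∀ y, M + 1 ≤ y → h y = 0 := fun y hy => by
    simp only [hdef]
    rw [Real.smoothTransition.zero_of_nonpos (by linarith), mul_zero]
  have hnn : ∀ y, 0 ≤ h y := fun y =>
    mul_nonneg (Real.exp_pos _).le (Real.smoothTransition.nonneg _)
  have hle : ∀ y, h y ≤ Real.exp y := fun y =>
    mul_le_of_le_one_right (Real.exp_pos _).le (Real.smoothTransition.le_one _)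
  refine ⟨h, hs, h1, hnn, hle, ⟨Real.exp (M + 1), fun y => ?_⟩, ?_⟩
  · rw [abs_of_nonneg (hnn y)]
    rcases le_total y (M + 1) with hy | hy
    · exact (hle y).trans (Real.exp_le_exp.2 hy)
    · rw [h0 y hy]; positivity
  · have hdc : Continuous (deriv h) :=
      (hs.of_le (by simp : (1 : WithTop ℕ∞) ≤ ∞)).continuous_deriv le_rfl
    obtain ⟨C, hC⟩ := (isCompact_Icc (a := M) (b := M + 1)).exists_bound_of_continuousOn
      hdc.continuousOn
    have hb : ∀ y, ‖deriv h y‖ ≤ max C (Real.exp M) := by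
      intro y
      rcases lt_or_ge y M with hy | hy
      · have : h =ᶠ[𝓝 y] Real.exp := by
          filter_upwards [Iio_mem_nhds hy] with z hz using h1 z hz.le
        rw [this.deriv_eq, Real.deriv_exp, Real.norm_eq_abs, Real.abs_exp]
        exact (Real.exp_le_exp.2 hy.le).trans (le_max_right _ _)
      rcases le_or_gt y (M + 1) with hy' | hy'
      · exact (hC y ⟨hy, hy'⟩).trans (le_max_left _ _)
      · have : h =ᶠ[𝓝 y] fun _ => 0 := by
          filter_upwards [Ioi_mem_nhds hy'] with z hz using h0 z (le_of_lt hz)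
        rw [this.deriv_eq]
        simp only [deriv_const, norm_zero]
        exact (Real.exp_pos M).le.trans (le_max_right _ _)
    refine ⟨max C (Real.exp M), (Real.exp_pos M).le.trans (le_max_right _ _), fun x y => ?_⟩
    exact convex_univ.norm_image_sub_le_of_norm_deriv_le
      (fun z _ => (hs.differentiable (by simp)) z) (fun z _ => hb z) (mem_univ y) (mem_univ x)

/-! ### Decay of the profile and removal of the truncation -/

/-- For t ≤ δ the term in `b` gives no help, but (δ + t)^m ≤ 2δ is small. For t ≥ δ every lower
power of t is at most δ⁻ⁿ tⁿ, so a very negative `b` dominates the rest of the exponent. -/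
theorem exists_exp_poly_decay {n m : ℕ} (hn : 1 ≤ n) (hm : 1 ≤ m) {K c A : ℝ} (hK : 0 ≤ K)
    (hc : 0 < c) (hA : 0 < A) : ∃ δ, 0 < δ ∧ δ ≤ 1 ∧ ∃ β, ∀ b ≤ β, ∀ t, 0 ≤ t →
      A * Real.exp (K * ∑ k ∈ Finset.range n, t ^ k + b * c * t ^ n) * (δ + t) ^ m ≤ 1 := by
  set x := A * Real.exp (K * n) with hx
  have hx0 : 0 < x := by positivity
  set δ := 1 / (2 * (x + 1)) with hδ
  have hδ0 : 0 < δ := by positivity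
  have h2δ : 2 * δ = 1 / (x + 1) := by rw [hδ]; field_simp
  have h2δ1 : 2 * δ ≤ 1 := by rw [h2δ, div_le_one (by positivity)]; linarith
  set D := (δ⁻¹) ^ n with hD
  have hD0 : 0 < D := by positivity
  -- The three summands pay for A, for the lower-order terms, and for (δ + t)^m ≤ e^{2mt}.
  set E := D * (|Real.log A| + K * n + 2 * m) with hE
  have hE0 : 0 ≤ E := by positivity
  refine ⟨δ, hδ0, by linarith, -E / c, fun b hb t ht => ?_⟩
  have hbc : b * c ≤ -E := by rwa [le_div_iff₀ hc] at hb
  rcases le_total t δ with htδ | htδ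
  · have h1 : K * ∑ k ∈ Finset.range n, t ^ k ≤ K * n := by
      gcongr
      calc ∑ k ∈ Finset.range n, t ^ k ≤ ∑ k ∈ Finset.range n, (1:ℝ) :=
            Finset.sum_le_sum fun k _ => pow_le_one₀ ht (by linarith)
        _ = n := by simp
    have h2 : b * c * t ^ n ≤ 0 := mul_nonpos_of_nonpos_of_nonneg (by linarith) (by positivity)
    have h3 : (δ + t) ^ m ≤ 2 * δ := by
      calc (δ + t) ^ m ≤ (2 * δ) ^ m := by gcongr; linarith
        _ ≤ (2 * δ) ^ 1 := pow_le_pow_of_le_one (by positivity) h2δ1 hm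
        _ = _ := pow_one _
    calc _ ≤ A * Real.exp (K * n) * (2 * δ) := by gcongr; linarith
      _ = x / (x + 1) := by rw [← hx, h2δ]; ring
      _ ≤ 1 := by rw [div_le_one (by positivity)]; linarith
  · have hpow : ∀ k ≤ n, t ^ k ≤ D * t ^ n := by
      intro k hk
      have h1 : t ^ n = t ^ k * t ^ (n - k) := by rw [← pow_add]; congr 1; omega
      have h2 : δ ^ n ≤ t ^ (n - k) := by
        calc δ ^ n ≤ δ ^ (n - k) := pow_le_pow_of_le_one hδ0.le (by linarith) (Nat.sub_le _ _)
          _ ≤ _ := by gcongr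
      have h3 : D * δ ^ n = 1 := by
        rw [hD, ← mul_pow, inv_mul_cancel₀ hδ0.ne', one_pow]
      calc t ^ k = (D * δ ^ n) * t ^ k := by rw [h3, one_mul]
        _ ≤ (D * t ^ (n - k)) * t ^ k := by gcongr
        _ = D * t ^ n := by rw [h1]; ring
    have h1 : K * ∑ k ∈ Finset.range n, t ^ k ≤ K * (n * (D * t ^ n)) := by
      gcongr
      calc ∑ k ∈ Finset.range n, t ^ k ≤ ∑ k ∈ Finset.range n, D * t ^ n :=
            Finset.sum_le_sum fun k hk => hpow k (Finset.mem_range.1 hk).le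
        _ = _ := by simp
    have h2 : Real.log A ≤ |Real.log A| * (D * t ^ n) := by
      have := hpow 0 (by omega)
      rw [pow_zero] at this
      exact (le_abs_self _).trans (le_mul_of_one_le_right (abs_nonneg _) this)
    have h3 : m * (2 * t) ≤ 2 * m * (D * t ^ n) := by
      have := hpow 1 hn
      rw [pow_one] at this
      calc (m:ℝ) * (2 * t) = 2 * m * t := by ring
        _ ≤ _ := by gcongr
    have h4 : (δ + t) ^ m ≤ Real.exp (m * (2 * t)) := by
      rw [Real.exp_nat_mul]
      gcongr
      linarith [Real.add_one_le_exp (2 * t)]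
    have h5 : b * c * t ^ n ≤ -E * t ^ n := mul_le_mul_of_nonneg_right hbc (by positivity)
    calc A * Real.exp (K * ∑ k ∈ Finset.range n, t ^ k + b * c * t ^ n) * (δ + t) ^ m
        ≤ A * Real.exp (K * ∑ k ∈ Finset.range n, t ^ k + b * c * t ^ n)
          * Real.exp (m * (2 * t)) := by gcongr
      _ = Real.exp (Real.log A + (K * ∑ k ∈ Finset.range n, t ^ k + b * c * t ^ n)
          + m * (2 * t)) := by
        rw [Real.exp_add (Real.log A + _), Real.exp_add (Real.log A), Real.exp_log hA]
      _ ≤ 1 := by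
        rw [Real.exp_le_one_iff]
        have : E * t ^ n = |Real.log A| * (D * t ^ n) + K * (n * (D * t ^ n))
          + 2 * m * (D * t ^ n) := by rw [hE]; ring
        linarith

/-- Existence of the profile, as a function of `t = r²`. -/
theorem exists_profile {n m : ℕ} (hn : 1 ≤ n) (hm : 2 ≤ m) (hN : 5 ≤ N) {A : ℝ} (hA : 0 < A)
    (α : ℕ → ℝ) : ∃ δ, 0 < δ ∧ ∃ β : ℝ, ∀ b ≤ β, ∃ g : ℝ → ℝ, ContDiff ℝ ∞ g ∧
      (∀ k < n, (sqLaplacian N)^[k] g 0 = α k) ∧ (sqLaplacian N)^[n] g 0 = b ∧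
      (∀ t, 0 ≤ t → (sqLaplacian N)^[n + 1] g t = (-1) ^ (n + 1) * Real.exp (g t)) ∧
      ∀ t, 0 ≤ t → A * Real.exp (g t) * (δ + t) ^ m ≤ 1 := by
  have hN1 : 1 ≤ N := by omega
  obtain ⟨K, c, hK, hc, hQ⟩ := exists_sqSolve_const_le hN1 α n
  obtain ⟨δ, hδ, hδ1, β, hβ⟩ := exists_exp_poly_decay hn (by omega : 1 ≤ m) hK hc hA
  set C := (A * δ ^ m)⁻¹ with hCdef
  have hC : 0 < C := by positivity
  -- The barrier has b/2 in place of b, hence 2β. The nonlinear term raises F by at most C/2, and b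
  -- < -C makes b + C/2 < b/2. `C` is fixed before `b`.
  refine ⟨δ, hδ, min (2 * β) (-(C + 1)), fun b hb => ?_⟩
  have hb1 : b / 2 ≤ β := by linarith [hb.trans (min_le_left _ _)]
  have hb2 : b ≤ -(C + 1) := hb.trans (min_le_right _ _)
  set Q := sqSolve N α n (fun _ => b / 2)
  have hQA : ∀ t, 0 ≤ t → A * Real.exp (Q t) * (δ + t) ^ m ≤ 1 := by
    intro t ht
    refine le_trans ?_ (hβ _ hb1 t ht)
    gcongr
    exact hQ _ t ht
  have hQC : ∀ t, 0 ≤ t → Real.exp (Q t) ≤ C * ((1 + t) ^ 2)⁻¹ := by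
    intro t ht
    -- Both δ ≤ 1 and m ≥ 2 are needed to reach the decay (1 + t)⁻².
    have h1 : δ ^ m * (1 + t) ^ 2 ≤ (δ + t) ^ m := by
      calc δ ^ m * (1 + t) ^ 2 ≤ δ ^ m * (1 + t) ^ m := by
            gcongr
            · linarith
        _ = (δ * (1 + t)) ^ m := by rw [mul_pow]
        _ ≤ (δ + t) ^ m := by gcongr; nlinarith
    have h2 : A * Real.exp (Q t) * (δ ^ m * (1 + t) ^ 2) ≤ 1 :=
      le_trans (by gcongr) (hQA t ht)
    rw [hCdef, ← mul_inv, ← one_div, le_div_iff₀ (by positivity)]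
    linarith
  have hQM : ∀ t, 0 ≤ t → Q t ≤ Real.log C := by
    intro t ht
    rw [Real.le_log_iff_exp_le hC]
    refine (hQC t ht).trans (mul_le_of_le_one_right hC.le (inv_le_one_of_one_le₀ ?_))
    exact one_le_pow₀ (by linarith)
  obtain ⟨h, hhs, hhe, hh0, hhle, ⟨H, hH⟩, L, hL0, hL⟩ := exists_truncated_exp (Real.log C)
  have hε : |((-1) ^ (n + 1) : ℝ)| = 1 := by simp
  obtain ⟨g, hgc, hg⟩ := exists_truncated_solution (N := N) hhs.continuous hH hL0 hL hε α n b
  have hgs := contDiff_of_eq_sqSolve hhs hgc hg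
  set ε : ℝ := (-1) ^ (n + 1)
  set F : ℝ → ℝ := fun t => b + ε * sqInv N (fun s => h (g s)) t with hF
  have hhg : Continuous fun s => h (g s) := hhs.continuous.comp hgc
  have hFc : Continuous F := continuous_const.add (continuous_const.mul (continuous_sqInv hhg))
  have hhgs : ContDiff ℝ 1 fun s => h (g s) := (hhs.comp hgs).of_le (by simp)
  have hFs : ContDiff ℝ 1 F :=
    contDiff_const.add (contDiff_const.mul ((contDiff_sqInv 1 hhgs).of_le (by norm_num)))
  have step : ∀ T, (∀ t ∈ Icc 0 T, F t ≤ b / 2) → ∀ t ∈ Icc 0 T, g t ≤ Q t := by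
    intro T hT t ht
    rw [hg]
    exact sqSolve_mono hFc continuous_const hT α n t ht
  have hF0 : F 0 = b := by simp [hF, sqInv_zero]
  have hlt : ∀ t, 0 ≤ t → F t < b / 2 := by
    -- Continuation argument: let T be the first time at which F reaches b/2. Up to T the barrier
    -- gives g ≤ Q, and the resulting decay forces F(T) ≤ b + C/2 < b/2.
    by_contra! hcon
    set S := {t : ℝ | 0 ≤ t ∧ b / 2 ≤ F t}
    have hScl : IsClosed S := isClosed_Ici.inter (isClosed_le continuous_const hFc)
    have hSb : BddBelow S := ⟨0, fun t ht => ht.1⟩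
    have hmem := hScl.csInf_mem hcon hSb
    set T := sInf S
    have hT0 : 0 < T := by
      refine lt_of_le_of_ne hmem.1 fun h => ?_
      have := hmem.2
      rw [← h, hF0] at this
      linarith
    have hle : ∀ t ∈ Icc 0 T, F t ≤ b / 2 := by
      rw [← closure_Ico hT0.ne]
      refine closure_minimal (s := Ico 0 T) (t := {t | F t ≤ b / 2}) (fun t ht => ?_)
        (isClosed_le hFc continuous_const)
      by_contra hlt
      exact absurd (csInf_le hSb ⟨ht.1, (not_le.1 hlt).le⟩) (not_le.2 ht.2)
    have hgQ := step T hle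
    have hdec := sqInv_le_of_decay hN hC.le (T := T) (hhg.const_mul ε) (fun t ht => by
      -- Only an upper bound on F is needed, so both signs ε = ±1 are covered, using h ≥ 0.
      have h1 : ε * h (g t) ≤ h (g t) := by
        have : ε ≤ 1 := hε ▸ le_abs_self ε
        nlinarith [hh0 (g t)]
      exact h1.trans ((hhle _).trans ((Real.exp_le_exp.2 (hgQ t ht)).trans (hQC t ht.1))))
      T ⟨hT0.le, le_rfl⟩
    rw [sqInv_const_mul] at hdec
    have := hmem.2
    simp only [hF] at this
    linarith
  have hgQ : ∀ t, 0 ≤ t → g t ≤ Q t := fun t ht =>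
    step t (fun s hs => (hlt s hs.1).le) t ⟨ht, le_rfl⟩
  have hLn : (sqLaplacian N)^[n] g = F := by
    have := iterate_sqLaplacian_sqSolve hN1 hFs α 0 n
    rw [add_zero, ← hg] at this
    exact this
  refine ⟨g, hgs, fun k hk => ?_, by rw [hLn, hF0], fun t ht => ?_, fun t ht => ?_⟩
  · obtain ⟨j, rfl⟩ : ∃ j, n = k + (j + 1) := ⟨n - k - 1, by omega⟩
    have := iterate_sqLaplacian_sqSolve hN1 hFs α (j + 1) k
    rw [← hg] at this
    rw [this]
    simp [sqSolve, sqInv_zero]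
  · rw [Function.iterate_succ_apply', hLn, hF, sqLaplacian_const_add]
    have h1 : (fun t => ε * sqInv N (fun s => h (g s)) t)
        = sqInv N (fun s => ε * h (g s)) := funext fun s => (sqInv_const_mul _ _ _).symm
    rw [h1, sqLaplacian_sqInv hN1 (contDiff_const.mul hhgs)]
    simp only
    -- On t ≥ 0 the bound g ≤ Q ≤ log C puts g in the range where the truncation equals exp.
    rw [hhe _ ((hgQ t ht).trans (hQM t ht))]
  · refine le_trans ?_ (hQA t ht)
    have := hgQ t ht
    gcongr

end Solve
-- From the profile to functions of |x|²
section RadialFunctions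

variable {N : ℕ} {g : ℝ → ℝ}

theorem contDiff_deriv (hg : ContDiff ℝ ∞ g) : ContDiff ℝ ∞ (deriv g) :=
  (contDiff_infty_iff_deriv.1 hg).2

theorem contDiff_sqLaplacian (hg : ContDiff ℝ ∞ g) : ContDiff ℝ ∞ (sqLaplacian N g) :=
  ((contDiff_const.mul contDiff_id).mul (contDiff_deriv (contDiff_deriv hg))).add
    (contDiff_const.mul (contDiff_deriv hg))

theorem contDiff_sqLaplacian_iterate (hg : ContDiff ℝ ∞ g) (k : ℕ) :
    ContDiff ℝ ∞ ((sqLaplacian N)^[k] g) := by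
  induction k with
  | zero => exact hg
  | succ k ih =>
    rw [Function.iterate_succ_apply']
    exact contDiff_sqLaplacian ih

theorem contDiff_comp_normSq (hg : ContDiff ℝ ∞ g) :
    ContDiff ℝ ∞ (fun x : RN N => g (‖x‖ ^ 2)) :=
  hg.comp (contDiff_norm_sq ℝ)

theorem laplacian_comp_normSq (hg : ContDiff ℝ ∞ g) :
    Laplacian.laplacian (fun x : RN N => g (‖x‖ ^ 2)) = fun x => sqLaplacian N g (‖x‖ ^ 2) := by
  have hd : ∀ {f : ℝ → ℝ}, ContDiff ℝ ∞ f → ∀ t, HasDerivAt f (deriv f t) t := fun hf t =>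
    ((hf.differentiable (by simp)) t).hasDerivAt
  rw [laplacian_eq_sum_partialDeriv (contDiff_comp_normSq hg)]
  funext x
  have h1 : ∀ i, partialDeriv i (fun x : RN N => g (‖x‖ ^ 2))
      = fun x => 2 * (x i * deriv g (‖x‖ ^ 2)) := fun i => funext fun y => by
    rw [partialDeriv_comp_normSq i (hd hg _), mul_assoc]
  have h2 : ∀ i, partialDeriv i (fun x : RN N => 2 * (x i * deriv g (‖x‖ ^ 2))) x
      = 4 * deriv (deriv g) (‖x‖ ^ 2) * x i ^ 2 + 2 * deriv g (‖x‖ ^ 2) := fun i => by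
    rw [partialDeriv_const_mul i ((contDiff_coord i).mul (contDiff_comp_normSq (contDiff_deriv hg))),
      partialDeriv_mul i (contDiff_coord i) (contDiff_comp_normSq (contDiff_deriv hg)),
      partialDeriv_comp_normSq i (hd (contDiff_deriv hg) _), partialDeriv_coord]
    ring
  simp only [h1, h2, Finset.sum_add_distrib, ← Finset.mul_sum, ← EuclideanSpace.real_norm_sq_eq,
    Finset.sum_const, Finset.card_univ, Fintype.card_fin, nsmul_eq_mul, sqLaplacian]
  ring

theorem laplacian_iterate_comp_normSq (hg : ContDiff ℝ ∞ g) (k : ℕ) :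
    Laplacian.laplacian^[k] (fun x : RN N => g (‖x‖ ^ 2))
      = fun x => (sqLaplacian N)^[k] g (‖x‖ ^ 2) := by
  induction k with
  | zero => rfl
  | succ k ih =>
    rw [Function.iterate_succ_apply', ih, laplacian_comp_normSq (contDiff_sqLaplacian_iterate hg k),
      Function.iterate_succ_apply']

end RadialFunctions

/-! ### The radial Laplacian on (0, ∞) -/

section RadialLaplacian

variable {k : ℕ} {w : ℝ → ℝ}

theorem radialLaplacian_succ (k : ℕ) (w : ℝ → ℝ) (r : ℝ) :
    radialLaplacian (k + 1) w r = (r ^ k)⁻¹ * deriv (fun s => s ^ k * deriv w s) r := by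
  have h1 : (1 - ((k + 1 : ℕ) : ℤ)) = -(k : ℤ) := by push_cast; ring
  have h2 : (((k + 1 : ℕ) : ℤ) - 1) = (k : ℤ) := by push_cast; ring
  simp only [radialLaplacian, h1, h2, zpow_neg, zpow_natCast]

theorem radialLaplacian_congr {N : ℕ} {w₁ w₂ : ℝ → ℝ} (h : EqOn w₁ w₂ (Ioi 0)) :
    EqOn (radialLaplacian N w₁) (radialLaplacian N w₂) (Ioi 0) := by
  intro r hr
  have h1 : ∀ s ∈ Ioi (0:ℝ), deriv w₁ s = deriv w₂ s := fun s hs =>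
    (h.eventuallyEq_of_mem (Ioi_mem_nhds hs)).deriv_eq
  have h2 : (fun s => s ^ ((N : ℤ) - 1) * deriv w₁ s)
      =ᶠ[𝓝 r] fun s => s ^ ((N : ℤ) - 1) * deriv w₂ s := by
    filter_upwards [Ioi_mem_nhds hr] with s hs
    rw [h1 s hs]
  simp only [radialLaplacian, h2.deriv_eq]

theorem radialLaplacian_comp_sq {g : ℝ → ℝ} (hg : ContDiff ℝ ∞ g) {r : ℝ} (hr : 0 < r) :
    radialLaplacian (k + 1) (fun s => g (s ^ 2)) r = sqLaplacian (k + 1) g (r ^ 2) := by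
  have hd : ∀ {f : ℝ → ℝ}, ContDiff ℝ ∞ f → ∀ t, HasDerivAt f (deriv f t) t := fun hf t =>
    ((hf.differentiable (by simp)) t).hasDerivAt
  have hsq : ∀ s : ℝ, HasDerivAt (fun s : ℝ => s ^ 2) (2 * s) s := fun s => by
    simpa using hasDerivAt_pow 2 s
  have h1 : ∀ s, deriv (fun s => g (s ^ 2)) s = deriv g (s ^ 2) * (2 * s) := fun s =>
    ((hd hg (s ^ 2)).comp s (hsq s)).deriv
  have h2 : (fun s => s ^ k * deriv (fun s => g (s ^ 2)) s)
      = fun s => 2 * (s ^ (k + 1) * deriv g (s ^ 2)) := by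
    funext s; rw [h1]; ring
  have h3 : HasDerivAt (fun s => 2 * (s ^ (k + 1) * deriv g (s ^ 2)))
      (r ^ k * sqLaplacian (k + 1) g (r ^ 2)) r := by
    refine (((hasDerivAt_pow (k + 1) r).mul
      ((hd (contDiff_deriv hg) (r ^ 2)).comp r (hsq r))).const_mul 2).congr_deriv ?_
    simp only [sqLaplacian, Function.comp]
    push_cast [Nat.add_sub_cancel]
    ring
  rw [radialLaplacian_succ, h2, h3.deriv, inv_mul_cancel_left₀ (by positivity)]

theorem radialLaplacian_iterate_comp_sq {g : ℝ → ℝ} (hg : ContDiff ℝ ∞ g) (j : ℕ) :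
    EqOn ((radialLaplacian (k + 1))^[j] (fun s => g (s ^ 2)))
      (fun r => (sqLaplacian (k + 1))^[j] g (r ^ 2)) (Ioi 0) := by
  induction j with
  | zero => exact fun r _ => rfl
  | succ j ih =>
    intro r hr
    rw [Function.iterate_succ_apply', radialLaplacian_congr ih hr,
      radialLaplacian_comp_sq (contDiff_sqLaplacian_iterate hg j) hr, Function.iterate_succ_apply']

theorem contDiffOn_radialLaplacian {j : ℕ} (hw : ContDiffOn ℝ ((j + 2 : ℕ) : ℕ∞) w (Ioi 0)) :
    ContDiffOn ℝ (j : ℕ∞) (radialLaplacian (k + 1) w) (Ioi 0) := by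
  have h1 : ContDiffOn ℝ ((j + 1 : ℕ) : ℕ∞) (deriv w) (Ioi 0) :=
    hw.deriv_of_isOpen isOpen_Ioi (by norm_cast)
  have h2 : ContDiffOn ℝ ((j + 1 : ℕ) : ℕ∞) (fun s => s ^ k * deriv w s) (Ioi 0) :=
    (contDiff_id.pow k).contDiffOn.mul h1
  have h3 : ContDiffOn ℝ (j : ℕ∞) (deriv fun s => s ^ k * deriv w s) (Ioi 0) :=
    h2.deriv_of_isOpen isOpen_Ioi (by norm_cast)
  have h4 : radialLaplacian (k + 1) w
      = fun r => (r ^ k)⁻¹ * deriv (fun s => s ^ k * deriv w s) r :=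
    funext fun r => radialLaplacian_succ k w r
  rw [h4]
  refine ContDiffOn.mul ?_ h3
  exact ((contDiff_id.pow k).contDiffOn).inv fun r hr => pow_ne_zero k (ne_of_gt hr)

theorem contDiffOn_radialLaplacian_iterate {i j : ℕ}
    (hw : ContDiffOn ℝ ((2 * (i + j) : ℕ) : ℕ∞) w (Ioi 0)) :
    ContDiffOn ℝ ((2 * j : ℕ) : ℕ∞) ((radialLaplacian (k + 1))^[i] w) (Ioi 0) := by
  induction i generalizing j with
  | zero => simpa using hw
  | succ i ih =>
    rw [Function.iterate_succ_apply']
    refine contDiffOn_radialLaplacian (ih (j := j + 1) ?_)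
    convert hw using 3
    ring

theorem hasDerivAt_of_contDiffOn_two (hw : ContDiffOn ℝ 2 w (Ioi 0)) {r : ℝ} (hr : 0 < r) :
    HasDerivAt w (deriv w r) r ∧
      HasDerivAt (fun s => s ^ k * deriv w s) (r ^ k * radialLaplacian (k + 1) w r) r := by
  have h0 : Ioi (0:ℝ) ∈ 𝓝 r := Ioi_mem_nhds hr
  have h1 : ContDiffOn ℝ 1 (deriv w) (Ioi 0) := hw.deriv_of_isOpen isOpen_Ioi (by norm_num)
  refine ⟨((hw.differentiableOn (by simp)).differentiableAt h0).hasDerivAt, ?_⟩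
  have h2 : DifferentiableAt ℝ (fun s => s ^ k * deriv w s) r :=
    (by fun_prop : DifferentiableAt ℝ (fun s : ℝ => s ^ k) r).mul
      ((h1.differentiableOn (by simp)).differentiableAt h0)
  rw [radialLaplacian_succ, mul_inv_cancel_left₀ (by positivity)]
  exact h2.hasDerivAt

end RadialLaplacian

/-! ### Comparison for a single radial Laplacian -/

section Comparison

variable {k : ℕ} {R : ℝ}

/-- A radially subharmonic function with a limit at the origin lies above that limit. -/
theorem le_of_radially_subharmonic (hk : 1 ≤ k) {W W' G : ℝ → ℝ} {w₀ : ℝ}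
    (h1 : ∀ r ∈ Ioo 0 R, HasDerivAt W (W' r) r)
    (h2 : ∀ r ∈ Ioo 0 R, HasDerivAt (fun s => s ^ k * W' s) (G r) r)
    (h3 : ∀ r ∈ Ioo 0 R, 0 ≤ G r) (h4 : Tendsto W (𝓝[>] 0) (𝓝 w₀)) :
    ∀ r ∈ Ioo 0 R, w₀ ≤ W r := by
  have mono : ∀ {a b : ℝ} {f f' : ℝ → ℝ}, (∀ r ∈ Ioo a b, HasDerivAt f (f' r) r) →
      (∀ r ∈ Ioo a b, 0 ≤ f' r) → MonotoneOn f (Ioo a b) := by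
    intro a b f f' hf hf'
    refine monotoneOn_of_deriv_nonneg (convex_Ioo a b)
      (fun r hr => (hf r hr).continuousAt.continuousWithinAt) ?_ ?_
    · rw [interior_Ioo]
      exact fun r hr => (hf r hr).differentiableAt.differentiableWithinAt
    · rw [interior_Ioo]
      exact fun r hr => (hf r hr).deriv ▸ hf' r hr
  have hP := mono h2 h3
  have hW' : ∀ r ∈ Ioo 0 R, 0 ≤ W' r := by
    -- If the flux r^k W' is negative somewhere, by monotonicity it stays below -c down to the
    -- origin. Then W' ≤ -c/r for r < 1, so W blows up like -c log r, against the finite limit.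
    by_contra! hcon
    obtain ⟨r₀, hr₀, hneg⟩ := hcon
    set c := -(r₀ ^ k * W' r₀) with hc
    have hc0 : 0 < c := by
      have := pow_pos hr₀.1 k
      rw [hc]; nlinarith
    set b := min r₀ 1
    have hb : 0 < b := lt_min hr₀.1 one_pos
    have hsub : ∀ r ∈ Ioo 0 b, r ∈ Ioo 0 R := fun r hr =>
      ⟨hr.1, hr.2.trans_le ((min_le_left _ _).trans hr₀.2.le)⟩
    have hV := mono (a := 0) (b := b) (f := fun r => -(W r + c * Real.log r))
      (f' := fun r => -(W' r + c * r⁻¹))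
      (fun r hr => ((h1 r (hsub r hr)).add
        ((Real.hasDerivAt_log hr.1.ne').const_mul c)).neg)
      (fun r hr => by
        have h5 := hP (hsub r hr) hr₀ (hr.2.le.trans (min_le_left _ _))
        have h6 : r ^ k ≤ r := by
          calc r ^ k ≤ r ^ 1 :=
                pow_le_pow_of_le_one hr.1.le (hr.2.le.trans (min_le_right _ _)) hk
            _ = r := pow_one r
        have h7 : r ^ k * W' r ≤ -c := by simpa [hc] using h5
        have h8 : 0 < r ^ k := pow_pos hr.1 k
        have h9 : W' r < 0 := by
          by_contra! h
          nlinarith [mul_nonneg h8.le h]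
        have h10 : r * W' r ≤ -c := by nlinarith
        have h11 : W' r ≤ -c * r⁻¹ := by
          rw [← div_eq_mul_inv, le_div_iff₀ hr.1]; linarith
        linarith)
    have hr₁ : b / 2 ∈ Ioo 0 b := ⟨by positivity, by linarith⟩
    have hlog : Tendsto (fun r => W (b / 2) + c * Real.log (b / 2) + (-c) * Real.log r)
        (𝓝[>] 0) atTop :=
      tendsto_atTop_add_const_left _ _
        (Real.tendsto_log_nhdsGT_zero.const_mul_atBot_of_neg (by linarith))
    have htop : Tendsto W (𝓝[>] 0) atTop := by
      refine tendsto_atTop_mono' _ ?_ hlog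
      filter_upwards [Ioo_mem_nhdsGT hr₁.1] with r hr
      have := hV ⟨hr.1, hr.2.trans hr₁.2⟩ hr₁ hr.2.le
      simp only at this
      linarith
    exact not_tendsto_nhds_of_tendsto_atTop htop _ h4
  have hWm := mono h1 hW'
  intro r hr
  refine le_of_tendsto h4 ?_
  filter_upwards [Ioo_mem_nhdsGT hr.1] with s hs
  exact hWm ⟨hs.1, hs.2.trans hr.2⟩ hr hs.2.le

/-- With D = C/(2l), the barrier D e^{l r²} has radial Laplacian at least C e^{l r²}, so adding ±d
to it gives a radially subharmonic function with limit D ≥ 0 at the origin. This is the counterpart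
of `abs_sqInv_le` for functions known only on r > 0. -/
theorem abs_le_of_abs_radialLaplacian_le (hk : 1 ≤ k) {d d' F : ℝ → ℝ} {C l : ℝ} (hC : 0 ≤ C)
    (hl : 0 < l) (h1 : ∀ r ∈ Ioo 0 R, HasDerivAt d (d' r) r)
    (h2 : ∀ r ∈ Ioo 0 R, HasDerivAt (fun s => s ^ k * d' s) (r ^ k * F r) r)
    (h3 : ∀ r ∈ Ioo 0 R, |F r| ≤ C * Real.exp (l * r ^ 2)) (h4 : Tendsto d (𝓝[>] 0) (𝓝 0)) :
    ∀ r ∈ Ioo 0 R, |d r| ≤ C / (2 * l) * Real.exp (l * r ^ 2) := by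
  set D := C / (2 * l) with hD
  have hD0 : 0 ≤ D := by positivity
  have hDC : 2 * l * D = C := by rw [hD]; field_simp
  have hexp : ∀ s : ℝ, HasDerivAt (fun s => Real.exp (l * s ^ 2))
      (Real.exp (l * s ^ 2) * (l * (2 * s))) s := fun s => by
    have : HasDerivAt (fun s : ℝ => s ^ 2) (2 * s) s := by simpa using hasDerivAt_pow 2 s
    exact (this.const_mul l).exp
  have hlim : Tendsto (fun r : ℝ => D * Real.exp (l * r ^ 2)) (𝓝[>] 0) (𝓝 D) := by
    have : ContinuousAt (fun r : ℝ => D * Real.exp (l * r ^ 2)) 0 := by fun_prop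
    have h := this.tendsto.mono_left (nhdsWithin_le_nhds (s := Ioi 0))
    simpa using h
  have main : ∀ ε : ℝ, |ε| = 1 → ∀ r ∈ Ioo 0 R, 0 ≤ D * Real.exp (l * r ^ 2) + ε * d r := by
    intro ε hε r hr
    refine hD0.trans (le_of_radially_subharmonic hk
      (W := fun r => D * Real.exp (l * r ^ 2) + ε * d r)
      (W' := fun r => D * (Real.exp (l * r ^ 2) * (l * (2 * r))) + ε * d' r)
      (G := fun r => 2 * l * D * ((k + 1) * r ^ k * Real.exp (l * r ^ 2)
        + r ^ (k + 1) * (Real.exp (l * r ^ 2) * (l * (2 * r)))) + ε * (r ^ k * F r))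
      (fun s hs => ((hexp s).const_mul D).add ((h1 s hs).const_mul ε)) (fun s hs => ?_)
      (fun s hs => ?_) ?_ r hr)
    · have h5 : (fun r => r ^ k * (D * (Real.exp (l * r ^ 2) * (l * (2 * r))) + ε * d' r))
          = fun r => 2 * l * D * (r ^ (k + 1) * Real.exp (l * r ^ 2)) + ε * (r ^ k * d' r) := by
        funext r; ring
      rw [h5]
      refine ((((hasDerivAt_pow (k + 1) s).mul (hexp s)).const_mul (2 * l * D)).add
        ((h2 s hs).const_mul ε)).congr_deriv ?_
      push_cast [Nat.add_sub_cancel]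
      ring
    · have hs0 := hs.1
      have h5 : -(C * Real.exp (l * s ^ 2)) ≤ ε * F s := by
        have : |ε * F s| ≤ C * Real.exp (l * s ^ 2) := by
          rw [abs_mul, hε, one_mul]; exact h3 s hs
        exact (abs_le.1 this).1
      have h6 : 0 ≤ s ^ k * (ε * F s + C * Real.exp (l * s ^ 2)) :=
        mul_nonneg (by positivity) (by linarith)
      have h7 : 0 ≤ C * (k * s ^ k * Real.exp (l * s ^ 2)
          + s ^ (k + 1) * (Real.exp (l * s ^ 2) * (l * (2 * s)))) := by positivity
      rw [hDC]
      linarith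
    · have := hlim.add (h4.const_mul ε)
      simpa using this
  intro r hr
  have h5 := main 1 (by simp) r hr
  have h6 := main (-1) (by simp) r hr
  rw [abs_le]
  constructor <;> linarith

end Comparison

/-! ### Uniqueness -/

section Uniqueness

variable {k m : ℕ} {a : Fin m → ℝ} {u v : ℝ → ℝ}

theorem IsGlobalSolution.apply_zero {N : ℕ} (hm : 0 < m) (hu : IsGlobalSolution N m a u) :
    u 0 = a ⟨0, hm⟩ := by
  have h1 : Tendsto u (𝓝[>] 0) (𝓝 (u 0)) :=
    (hu.contDiffOn.continuousOn 0 self_mem_Ici).mono_left (nhdsWithin_mono _ Ioi_subset_Ici_self)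
  exact tendsto_nhds_unique h1 (hu.initial ⟨0, hm⟩)

theorem abs_exp_sub_exp_le {x y M : ℝ} (hx : x ≤ M) (hy : y ≤ M) :
    |Real.exp x - Real.exp y| ≤ Real.exp M * |x - y| :=
  (convex_Iic M).norm_image_sub_le_of_norm_deriv_le (f := Real.exp)
    (fun z _ => Real.differentiable_exp z)
    (fun z hz => by rw [Real.deriv_exp, Real.norm_eq_abs, Real.abs_exp]; exact Real.exp_le_exp.2 hz)
    hy hx

/-- Solutions of the initial value problem are unique. -/
theorem IsGlobalSolution.eqOn (hk : 1 ≤ k) (hm : 0 < m) (hu : IsGlobalSolution (k + 1) m a u)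
    (hv : IsGlobalSolution (k + 1) m a v) : EqOn v u (Ici 0) := by
  intro r₀ hr₀
  rcases eq_or_lt_of_le (mem_Ici.1 hr₀) with h0 | hpos
  · rw [← h0, hu.apply_zero hm, hv.apply_zero hm]
  set R := r₀ + 1
  have bound : ∀ {f : ℝ → ℝ}, IsGlobalSolution (k + 1) m a f → ∃ C, ∀ r ∈ Ioo 0 R, |f r| ≤ C := by
    intro f hf
    obtain ⟨C, hC⟩ := (isCompact_Icc (a := 0) (b := R)).exists_bound_of_continuousOn
      (hf.contDiffOn.continuousOn.mono Icc_subset_Ici_self)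
    exact ⟨C, fun r hr => hC r ⟨hr.1.le, hr.2.le⟩⟩
  obtain ⟨A, hA⟩ := bound hu
  obtain ⟨B, hB⟩ := bound hv
  set M := max A B
  set L := Real.exp M
  have hL : 0 < L := Real.exp_pos M
  have hl : 0 < L + 1 := by linarith
  set T := radialLaplacian (k + 1)
  have hC2 : ∀ {f : ℝ → ℝ}, IsGlobalSolution (k + 1) m a f → ∀ i < m,
      ContDiffOn ℝ 2 (T^[i] f) (Ioi 0) := by
    intro f hf i hi
    obtain ⟨j, rfl⟩ : ∃ j, m = i + (j + 1) := ⟨m - i - 1, by omega⟩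
    refine (contDiffOn_radialLaplacian_iterate (k := k) (i := i) (j := j + 1)
      (hf.contDiffOn.mono Ioi_subset_Ici_self)).of_le ?_
    exact WithTop.coe_le_coe.2 (Nat.cast_le.2 (by omega : 2 ≤ 2 * (j + 1)))
  have hTm : ∀ {f : ℝ → ℝ}, IsGlobalSolution (k + 1) m a f → ∀ r, 0 < r →
      T^[m] f r = (-1) ^ m * Real.exp (f r) := by
    intro f hf r hr
    rw [← hf.equation r hr, ← mul_assoc, ← mul_pow]
    simp [T]
  -- From the m-th Laplacian down to the function, every inversion divides by 2(L+1). One such gain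
  -- is kept; the others are only used not to increase the constant.
  have descend : ∀ C, 0 ≤ C →
      (∀ r ∈ Ioo 0 R, |T^[m] u r - T^[m] v r| ≤ C * Real.exp ((L + 1) * r ^ 2)) →
      ∀ i < m, ∀ r ∈ Ioo 0 R, |T^[m - 1 - i] u r - T^[m - 1 - i] v r|
        ≤ C / (2 * (L + 1)) * Real.exp ((L + 1) * r ^ 2) := by
    intro C hC hCm i hi
    have step : ∀ j < m, ∀ E, 0 ≤ E →
        (∀ r ∈ Ioo 0 R, |T^[j + 1] u r - T^[j + 1] v r| ≤ E * Real.exp ((L + 1) * r ^ 2)) →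
        ∀ r ∈ Ioo 0 R, |T^[j] u r - T^[j] v r|
          ≤ E / (2 * (L + 1)) * Real.exp ((L + 1) * r ^ 2) := by
      intro j hj E hE hEj
      refine abs_le_of_abs_radialLaplacian_le hk
        (d' := fun r => deriv (T^[j] u) r - deriv (T^[j] v) r)
        (F := fun r => T^[j + 1] u r - T^[j + 1] v r) hE hl (fun r hr => ?_) (fun r hr => ?_) hEj ?_
      · exact (hasDerivAt_of_contDiffOn_two (k := k) (hC2 hu j hj) hr.1).1.sub
          (hasDerivAt_of_contDiffOn_two (k := k) (hC2 hv j hj) hr.1).1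
      · simp only [mul_sub, Function.iterate_succ_apply']
        exact (hasDerivAt_of_contDiffOn_two (k := k) (hC2 hu j hj) hr.1).2.sub
          (hasDerivAt_of_contDiffOn_two (k := k) (hC2 hv j hj) hr.1).2
      · simpa using (hu.initial ⟨j, hj⟩).sub (hv.initial ⟨j, hj⟩)
    induction i with
    | zero =>
      refine step (m - 1 - 0) (by omega) C hC ?_
      have : m - 1 - 0 + 1 = m := by omega
      rwa [this]
    | succ i ih =>
      have h1 := step (m - 1 - (i + 1)) (by omega) (C / (2 * (L + 1))) (by positivity) (by
        have : m - 1 - (i + 1) + 1 = m - 1 - i := by omega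
        rw [this]
        exact ih (by omega))
      intro r hr
      refine (h1 r hr).trans ?_
      gcongr
      exact div_le_self (by positivity) (by linarith)
  -- The Lipschitz constant L of exp on the common range costs less than the gain: L/(2(L+1)) ≤ 1/2.
  -- Iterating forces the difference to vanish.
  have half : ∀ S, 0 ≤ S → (∀ r ∈ Ioo 0 R, |u r - v r| ≤ S * Real.exp ((L + 1) * r ^ 2)) →
      ∀ r ∈ Ioo 0 R, |u r - v r| ≤ S / 2 * Real.exp ((L + 1) * r ^ 2) := by
    intro S hS h r hr
    have h1 := descend (L * S) (by positivity) (fun s hs => by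
      rw [hTm hu s hs.1, hTm hv s hs.1, ← mul_sub, abs_mul, abs_pow, abs_neg, abs_one, one_pow,
        one_mul, mul_assoc]
      refine (abs_exp_sub_exp_le (M := M) ?_ ?_).trans ?_
      · exact (le_abs_self _).trans ((hA s hs).trans (le_max_left _ _))
      · exact (le_abs_self _).trans ((hB s hs).trans (le_max_right _ _))
      · exact mul_le_mul_of_nonneg_left (h s hs) hL.le) (m - 1) (by omega) r hr
    rw [Nat.sub_self] at h1
    refine h1.trans ?_
    gcongr ?_ * _
    rw [div_le_div_iff₀ (by positivity) (by positivity)]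
    nlinarith
  have iter : ∀ n : ℕ, ∀ r ∈ Ioo 0 R,
      |u r - v r| ≤ (A + B) * (1 / 2) ^ n * Real.exp ((L + 1) * r ^ 2) := by
    have hAB : 0 ≤ A + B := add_nonneg
      ((abs_nonneg _).trans (hA r₀ ⟨hpos, by simp [R]⟩))
      ((abs_nonneg _).trans (hB r₀ ⟨hpos, by simp [R]⟩))
    intro n
    induction n with
    | zero =>
      intro r hr
      rw [pow_zero, mul_one]
      refine (abs_sub _ _).trans ((add_le_add (hA r hr) (hB r hr)).trans ?_)
      exact le_mul_of_one_le_right hAB (Real.one_le_exp (by positivity))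
    | succ n ih =>
      intro r hr
      refine (half _ (by positivity) ih r hr).trans_eq ?_
      ring
  have hlim : Tendsto (fun n : ℕ => (A + B) * (1 / 2 : ℝ) ^ n * Real.exp ((L + 1) * r₀ ^ 2)) atTop
      (𝓝 0) := by
    have := ((tendsto_pow_atTop_nhds_zero_of_lt_one (r := (1 / 2 : ℝ)) (by norm_num)
      (by norm_num)).const_mul (A + B)).mul_const (Real.exp ((L + 1) * r₀ ^ 2))
    simpa using this
  have h0 : |u r₀ - v r₀| ≤ 0 :=
    ge_of_tendsto hlim (Eventually.of_forall fun n => iter n r₀ ⟨hpos, by simp [R]⟩)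
  have := abs_eq_zero.1 (le_antisymm h0 (abs_nonneg _))
  linarith

end Uniqueness

/-! ### Assembly -/

/-- A smooth profile in `t = r²` yields a global solution. -/
theorem isGlobalSolution_comp_sq {k m : ℕ} {a : Fin m → ℝ} {g : ℝ → ℝ} (hg : ContDiff ℝ ∞ g)
    (h0 : ∀ j : Fin m, (sqLaplacian (k + 1))^[j] g 0 = a j)
    (heq : ∀ t, 0 ≤ t → (sqLaplacian (k + 1))^[m] g t = (-1) ^ m * Real.exp (g t)) :
    IsGlobalSolution (k + 1) m a (fun r => g (r ^ 2)) where
  contDiffOn := ((hg.comp (contDiff_id.pow 2)).of_le (by exact_mod_cast le_top)).contDiffOn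
  equation r hr := by
    rw [radialLaplacian_iterate_comp_sq hg m hr]
    simp only
    rw [heq _ (sq_nonneg r), ← mul_assoc, ← mul_pow]
    simp
  odd_deriv j _ := by
    have hs : ContDiff ℝ ∞ (fun r : ℝ => g (r ^ 2)) := hg.comp (contDiff_id.pow 2)
    rw [iteratedDerivWithin_eq_iteratedDeriv (uniqueDiffOn_Ici 0)
      ((contDiff_infty.1 hs _).contDiffAt) self_mem_Ici]
    -- The function is even on ℝ, so each odd derivative at 0 equals its own negative.
    have h := iteratedDeriv_comp_neg (2 * j + 1) (fun r : ℝ => g (r ^ 2)) 0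
    simp only [neg_sq, neg_zero, (odd_two_mul_add_one j).neg_one_pow, neg_smul, one_smul] at h
    linarith
  initial j := by
    have hc : ContinuousAt (fun r : ℝ => (sqLaplacian (k + 1))^[j] g (r ^ 2)) 0 :=
      ((contDiff_sqLaplacian_iterate hg j).continuous.comp (continuous_pow 2)).continuousAt
    have h := hc.tendsto.mono_left (nhdsWithin_le_nhds (s := Ioi 0))
    simp only [ne_eq, OfNat.ofNat_ne_zero, not_false_eq_true, zero_pow, h0] at h
    refine h.congr' ?_
    filter_upwards [self_mem_nhdsWithin] with r hr
    exact (radialLaplacian_iterate_comp_sq hg j hr).symm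

end Polyharmonic

open Polyharmonic in
theorem theorem1p1 (m N : ℕ) (hm : 2 ≤ m) (hN : 2 * m < N) (a₀ : Fin (m - 1) → ℝ) :
    ∃ β : ℝ, ∀ a : Fin m → ℝ,
      (∀ k : Fin (m - 1), a ⟨(k : ℕ), by omega⟩ = a₀ k) →
      a ⟨m - 1, by omega⟩ ≤ β →
        ∃ u : ℝ → ℝ, Polyharmonic.IsGlobalSolution N m a u ∧
          (∀ v : ℝ → ℝ, Polyharmonic.IsGlobalSolution N m a v → EqOn v u (Ici 0)) ∧
          Polyharmonic.IsStableSolution N m (Polyharmonic.radialFunction N u) := by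
  obtain ⟨k, rfl⟩ : ∃ k, N = k + 1 := ⟨N - 1, by omega⟩
  obtain ⟨n, rfl⟩ : ∃ n, m = n + 1 := ⟨m - 1, by omega⟩
  -- The constant A = 16^m is the one lost in `energy_ge`. The sequence is built from `a₀` alone, so
  -- β is fixed before `a`; its default 0 is irrelevant, as only indices below n are compared with
  -- the data.
  obtain ⟨δ, hδ, β, hβ⟩ := exists_profile (N := k + 1) (n := n) (m := n + 1) (by omega) hm
    (by omega) (A := 16 ^ (n + 1)) (by positivity)
    (fun j => if h : j < n then a₀ ⟨j, h⟩ else 0)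
  refine ⟨β, fun a ha hle => ?_⟩
  obtain ⟨g, hg, hinit, hlast, heq, hdecay⟩ := hβ _ hle
  have h0 : ∀ j : Fin (n + 1), (sqLaplacian (k + 1))^[j] g 0 = a j := by
    rintro ⟨j, hj⟩
    rcases Nat.lt_succ_iff_lt_or_eq.1 hj with hjn | rfl
    · rw [hinit j hjn, dif_pos hjn]
      exact (ha ⟨j, hjn⟩).symm
    · exact hlast
  have hsol := isGlobalSolution_comp_sq hg h0 heq
  refine ⟨_, hsol, fun v hv => hsol.eqOn (by omega) (by omega) hv, ?_⟩
  have hU : radialFunction (k + 1) (fun r => g (r ^ 2)) = fun x => g (‖x‖ ^ 2) := rfl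
  rw [hU]
  refine ⟨⟨contDiff_comp_normSq hg, fun x => ?_⟩, fun φ hφ hc => ?_⟩
  · rw [laplacian_iterate_comp_normSq hg]
    simp only
    rw [heq _ (sq_nonneg _), ← mul_assoc, ← mul_pow]
    simp
  · refine energy_sub_nonneg (n + 1) hN hδ
      (V := fun x => Real.exp (g (‖x‖ ^ 2)))
      (Real.continuous_exp.comp (contDiff_comp_normSq hg).continuous) (fun x => ?_) hφ hc
    rw [weight, inv_pow, ← one_div, le_div_iff₀ (by positivity)]
    exact hdecay _ (sq_nonneg _)
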